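/- **Setting.** There are $n$ players and $m$ item types. For every player $i$ and type $k$ there is an unknown probability distribution $\nu_{ik}$ on $\mathbb R$ with mean $\mu^*_{ik}$, sub-Gaussian with variance proxy $\sigma^2$, i.e. $\mathbb E_{x\sim\nu_{ik}} e^{s(x-\mu^*_{ik})}\le e^{\sigma^2 s^2/2}$ for all $s\in\mathbb R$. A *fractional allocation* is a matrix $X\in[0,1]^{n\times m}$ with $\sum_i X_{ik}=1$ for every $k$; the uniform-at-random allocation $\mathrm{UAR}$ has all entries $1/n$. At each time $t=0,\dots,T-1$ an algorithm chooses a fractional allocation $X_t$ as a function of the history $H_t$ (the earlier item types, recipients and recipients' values); then an item with uniformly random type $k_t\in[m]$ arrives, the players' values for it are drawn independently from $\nu_{1k_t},\dots,\nu_{nk_t}$, and, independently of these values, the item is given to player $i$ with probability $(X_t)_{ik_t}$; only the recipient's value is observed. Write $\langle A,B\rangle_F=\sum_{i,k}A_{ik}B_{ik}$. The fairness constraints for a mean matrix $\mu$ are linear in $X$ and are one of the following two families: - envy-freeness in expectation: $\sum_k X_{ik}\mu_{ik}\ge\sum_k X_{i'k}\mu_{ik}$ for all players $i,i'$; - proportionality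 in expectation: $\sum_k X_{ik}\mu_{ik}\ge\frac1n\sum_{i'}\sum_k X_{i'k}\mu_{ik}$ for all players $i$. Let $Y^{\mu^*}$ be a fractional allocation maximizing $\langle Y,\mu^*\rangle_F$ among those that satisfy the constraints for $\mu^*$. The regret is $T\langle Y^{\mu^*},\mu^*\rangle_F-\sum_{t=0}^{T-1}\langle X_t,\mu^*\rangle_F$. **Fair Explore-Then-Commit.** For all times $t<T^{2/3}$ use $X_t=\mathrm{UAR}$. Let $N_{ik}$ be the number of these times at which an item of type $k$ was given to player $i$, let $\hat\mu_{ik}$ be the average of the $N_{ik}$ observed values, and let $\epsilon_{ik}=\sqrt{\log^2(4Tnm)/(2N_{ik})}$ (if $N_{ik}=0$, then $\epsilon_{ik}=\infty$ and $\hat\mu_{ik}=0$). Let $\hat X$ be any maximizer of $\langle X,\hat\mu\rangle_F$ over the fractional allocations $X$ that satisfy the constraints for every $\mu\in\mathbb R^{n\times m}$ with $|\mu_{ik}-\hat\mu_{ik}|\le\epsilon_{ik}$ for all $i,k$. For all times $T^{2/3}\le t<T$ use $X_t=\hat X$. **Theorem.** Let $n,m$, $0<a\le b$, $\sigma\ge0$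 and one of the two families of constraints be given. There are constants $C$, $p$ and $T_0$, depending only on these data, such that for every $T\ge T_0$ and all value distributions $\nu_{ik}$ as above with $a\le\mu^*_{ik}\le b$ for all $i,k$, with probability at least $1-1/T$ the Fair Explore-Then-Commit algorithm satisfies both of the following: 1. at every time $t\in\{0,\dots,T-1\}$ the allocation $X_t$ satisfies the fairness constraints for $\mu^*$; 2. its regret is at most $C\,T^{2/3}(\log T)^p$, that is, $\tilde O(T^{2/3})$. -/

import Mathlib

open MeasureTheory ProbabilityTheory
open scoped NNReal

namespace FairDivision

noncomputable section

/-! ### Fractional allocations and linear fairness constraints -/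

/-- Real `n × m` matrices, indexed by players and item types. -/
abbrev Mat (n m : ℕ) : Type := Fin n → Fin m → ℝ

/-- The Frobenius inner product. -/
def frob {n m : ℕ} (A B : Mat n m) : ℝ := ∑ i, ∑ k, A i k * B i k

/-- `X i k` is the probability that an item of type `k` is given to player `i`: every column is a
probability vector. -/
def IsAllocation {n m : ℕ} (X : Mat n m) : Prop :=
  (∀ i k, 0 ≤ X i k) ∧ ∀ k, ∑ i, X i k = 1

/-- The uniform-at-random allocation. -/
def uar (n m : ℕ) : Mat n m := fun _ _ => 1 / (n : ℝ)

/-- A family, indexed by mean matrices `μ`, of finite sets of linear constraints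
`⟨B ℓ μ, X⟩ ≥ c ℓ`. -/
structure ConstraintFamily (n m : ℕ) where
  /-- The labels of the constraints. -/
  L : Type
  /-- There are finitely many constraints. -/
  finite : Finite L
  /-- The constraint matrices, as functions of the mean matrix. -/
  B : L → Mat n m → Mat n m
  /-- The right-hand sides. -/
  c : L → ℝ

/-- `X` satisfies all the constraints of the family for the mean matrix `μ`. -/
def ConstraintFamily.Sat {n m : ℕ} (𝒞 : ConstraintFamily n m) (μ X : Mat n m) : Prop :=
  ∀ l, 𝒞.c l ≤ frob (𝒞.B l μ) X

/-- Envy-freeness in expectation. The constraint labelled by `(i, i')` reads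
`⟨X i, μ i⟩ - ⟨X i', μ i⟩ ≥ 0`. -/
def efConstraints (n m : ℕ) : ConstraintFamily n m where
  L := Fin n × Fin n
  finite := inferInstance
  B := fun l μ j k => (if j = l.1 then μ l.1 k else 0) - (if j = l.2 then μ l.1 k else 0)
  c := fun _ => 0

/-- Proportionality in expectation. The constraint labelled by `l` reads
`⟨X l, μ l⟩ ≥ (1 / n) * ∑ i, ⟨X i, μ l⟩`. -/
def propConstraints (n m : ℕ) : ConstraintFamily n m where
  L := Fin n
  finite := inferInstance
  B := fun l μ i k => if i = l then ((n : ℝ) - 1) / n * μ l k else -(1 / (n : ℝ)) * μ l k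
  c := fun _ => 0

/-- `X` maximizes `⟨X, μ⟩` over the set `S`. -/
def IsLPSolution {n m : ℕ} (S : Set (Mat n m)) (μ X : Mat n m) : Prop :=
  X ∈ S ∧ ∀ X' ∈ S, frob X' μ ≤ frob X μ

/-- The allocations that satisfy the constraints for `μ`. -/
def fairSet {n m : ℕ} (𝒞 : ConstraintFamily n m) (μ : Mat n m) : Set (Mat n m) :=
  {X | IsAllocation X ∧ 𝒞.Sat μ X}

/-- The allocations that satisfy the constraints for every mean matrix in the region `R`. -/
def robustFairSet {n m : ℕ} (𝒞 : ConstraintFamily n m) (R : Set (Mat n m)) : Set (Mat n m) :=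
  {X | IsAllocation X ∧ ∀ μ ∈ R, 𝒞.Sat μ X}

/-! ### The online process -/

/-- What the algorithm has observed before time `t`: for every earlier step the item type, the
player who received the item, and the value of that player for it. -/
abbrev History (n m t : ℕ) : Type := Fin t → Fin m × Fin n × ℝ

/-- An allocation algorithm: the fractional allocation used at time `t`, given the history. -/
abbrev Policy (n m : ℕ) : Type := (t : ℕ) → History n m t → Mat n m

/-- The observed history before time `t`, where `typ s`, `rec s` and `val s i` are the type of the
item of time `s`, its recipient, and the value of player `i` for it. -/
def history {Ω : Type*} {n m : ℕ} (typ : ℕ → Ω → Fin m) (rec : ℕ → Ω → Fin n)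
    (val : ℕ → Ω → Fin n → ℝ) (t : ℕ) (ω : Ω) : History n m t :=
  fun s => (typ s ω, rec s ω, val s ω (rec s ω))

/-- Everything that happened before time `t`, including the values that were not observed. -/
def fullPast {Ω : Type*} {n m : ℕ} (typ : ℕ → Ω → Fin m) (rec : ℕ → Ω → Fin n)
    (val : ℕ → Ω → Fin n → ℝ) (t : ℕ) (ω : Ω) : Fin t → Fin m × Fin n × (Fin n → ℝ) :=
  fun s => (typ s ω, rec s ω, val s ω)

/-- The random variables `typ`, `rec`, `val` follow the first `T` steps of the online process run
with the algorithm `alg` and the value distributions `ν i k`. Given the past, the type of the item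
of time `t` is uniform on the `m` types; given also that the type is `κ`, the recipient has the law
given by the column `κ` of `X_t = alg t H_t`, and, independently of the recipient, the players'
values for the item are independent with laws `ν i κ`. -/
structure IsOnlineProcess {Ω : Type*} [MeasurableSpace Ω] {n m : ℕ} (P : Measure Ω)
    (ν : Fin n → Fin m → Measure ℝ) [∀ i k, IsProbabilityMeasure (ν i k)]
    (alg : Policy n m) (T : ℕ) (typ : ℕ → Ω → Fin m) (rec : ℕ → Ω → Fin n)
    (val : ℕ → Ω → Fin n → ℝ) : Prop where
  measurable_typ : ∀ t, Measurable (typ t)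
  measurable_rec : ∀ t, Measurable (rec t)
  measurable_val : ∀ t, Measurable (val t)
  law : ∀ t < T, ∀ A : Set (Fin t → Fin m × Fin n × (Fin n → ℝ)), MeasurableSet A →
    ∀ (κ : Fin m) (i : Fin n) (D : Set (Fin n → ℝ)), MeasurableSet D →
      P {ω | fullPast typ rec val t ω ∈ A ∧ typ t ω = κ ∧ rec t ω = i ∧ val t ω ∈ D} =
        (∫⁻ ω in {ω | fullPast typ rec val t ω ∈ A},
          ENNReal.ofReal (1 / (m : ℝ) * alg t (history typ rec val t ω) i κ) ∂P) *
        Measure.pi (fun j => ν j κ) D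

/-- The matrix of the means of the value distributions. -/
def meanMatrix {n m : ℕ} (ν : Fin n → Fin m → Measure ℝ) : Mat n m :=
  fun i k => ∫ x, x ∂(ν i k)

/-- Every value distribution is sub-Gaussian with variance proxy `σ ^ 2`. -/
def IsSubGaussian {n m : ℕ} (ν : Fin n → Fin m → Measure ℝ) (σ : ℝ≥0) : Prop :=
  ∀ i k, HasSubgaussianMGF (fun x => x - meanMatrix ν i k) (σ ^ 2) (ν i k)

/-- The `T`-step regret along the outcome `ω`, where `μ` is the matrix of true means and `Y` is the
benchmark allocation. -/
def regret {Ω : Type*} {n m : ℕ} (alg : Policy n m) (μ Y : Mat n m) (T : ℕ)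
    (typ : ℕ → Ω → Fin m) (rec : ℕ → Ω → Fin n) (val : ℕ → Ω → Fin n → ℝ) (ω : Ω) : ℝ :=
  T * frob Y μ - ∑ t ∈ Finset.range T, frob (alg t (history typ rec val t ω)) μ

/-! ### Fair explore-then-commit -/

/-- The number of exploration steps: the times `t = 0, 1, …` with `t < T ^ (2 / 3)`. -/
def exploreLen (T : ℕ) : ℕ := ⌈(T : ℝ) ^ (2 / 3 : ℝ)⌉₊

/-- The number of times an item of type `k` was given to player `i`. -/
def count {n m t : ℕ} (h : History n m t) (i : Fin n) (k : Fin m) : ℕ :=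
  (Finset.univ.filter fun s => (h s).1 = k ∧ (h s).2.1 = i).card

/-- The empirical means. -/
def muHat {n m t : ℕ} (h : History n m t) : Mat n m :=
  fun i k => (∑ s, if (h s).1 = k ∧ (h s).2.1 = i then (h s).2.2 else 0) / (count h i k : ℝ)

/-- The confidence radii. -/
def radius {n m t : ℕ} (T : ℕ) (h : History n m t) : Mat n m :=
  fun i k => Real.sqrt (Real.log (4 * T * n * m) ^ 2 / (2 * (count h i k : ℝ)))

/-- The confidence box. A pair `(i, k)` that was never sampled has an infinite radius, that is, it
puts no restriction on the entry `(i, k)`. -/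
def confidenceBox {n m t : ℕ} (T : ℕ) (h : History n m t) : Set (Mat n m) :=
  {μ | ∀ i k, 0 < count h i k →
    muHat h i k - radius T h i k ≤ μ i k ∧ μ i k ≤ muHat h i k + radius T h i k}

/-- `Xhat` solves the robust linear program of horizon `T`, for all data from the exploration. -/
def IsRobustSolver {n m : ℕ} (𝒞 : ConstraintFamily n m) (T : ℕ)
    (Xhat : History n m (exploreLen T) → Mat n m) : Prop :=
  ∀ h, IsLPSolution (robustFairSet 𝒞 (confidenceBox T h)) (muHat h) (Xhat h)

/-- Fair explore-then-commit with horizon `T`: the uniform-at-random allocation at the times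
`t < T ^ (2 / 3)`; afterwards the allocation that the solver `Xhat` computes from the data of the
exploration steps. -/
def fairETC {n m : ℕ} (T : ℕ) (Xhat : History n m (exploreLen T) → Mat n m) : Policy n m :=
  fun t h =>
    if ht : t < exploreLen T then uar n m
    else Xhat fun s => h ⟨s, s.isLt.trans_le (not_lt.mp ht)⟩

end

end FairDivision

/-! The UAR allocation is fair for every mean matrix, so exploration costs only the regret of about
`T ^ (2 / 3)` steps. It yields estimates within some `ρ` of order `log T / T ^ (1 / 3)`, and with
high probability the true means lie in the confidence box, so the committed allocation is fair. It
remains to bound the price of robustness: some allocation must be fair for all means within `2 * ρ`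
of the truth and lose only `O(ρ)` against the best fair one (`exists_robust`). The total regret is
then `O(T ^ (2 / 3)) + T * O(ρ)`.

For envy-freeness, not every constraint can be given positive slack: identical players force ties.
But a tie between two equal bundles is harmless for every mean matrix. Hence the target is an
allocation in which any two bundles are equal or have slack at least `ε` (`Separated`).
`exists_separatesAt` finds it by induction on a set `R` of pairs, where pairs outside `R` already
have slack of a large multiple of `ε`. If a pair in `R` has large slack it leaves `R`; so assume
that all of `R` is nearly tight, and regard `R` as a directed graph. If an edge lies on no cycle,
giving a little extra to the players who can reach its source creates slack on it. If all edges lie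
on cycles but `R` is not transitive, rotating bundles along a cycle creates slack on a further edge.
Otherwise `R` is an equivalence relation, and averaging bundles within each class finishes. Each
move costs `O(ε)` welfare.

For proportionality (`exists_propSlack_le`), the slacks sum to the welfare gain over UAR. Either
this gain is `O(ε)` and UAR serves, or one player has slack to spare and can subsidise the others.

The estimates come from Chernoff bounds (`IsOnlineProcess.measure_not_goodData_le`): under UAR the
exploration steps are i.i.d. -/

namespace FairDivision

/-- The amount by which player `i` prefers her own bundle to the bundle of player `l`. -/
def slack {n m : ℕ} (μ X : Mat n m) (i l : Fin n) : ℝ := ∑ k, (X i k - X l k) * μ i k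

/-! ### Allocations, convex mixtures and redistribution of bundles. -/

section Allocations

variable {n m : ℕ}

lemma slack_self (μ X : Mat n m) (i : Fin n) : slack μ X i i = 0 := by simp [slack]

lemma slack_of_eq {μ X : Mat n m} {i l : Fin n} (h : X i = X l) : slack μ X i l = 0 := by
  simp [slack, h]

lemma isAllocation_uar (hn : 0 < n) : IsAllocation (uar n m) := by
  refine ⟨fun i k => by simp [uar], fun k => ?_⟩
  have : (n : ℝ) ≠ 0 := by positivity
  simp [uar, this]

lemma IsAllocation.le_one {X : Mat n m} (hX : IsAllocation X) (i : Fin n) (k : Fin m) :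
    X i k ≤ 1 := by
  rw [← hX.2 k]
  exact Finset.single_le_sum (f := fun j => X j k) (fun j _ => hX.1 j k) (Finset.mem_univ i)

lemma IsAllocation.frob_le {X A : Mat n m} (hX : IsAllocation X) {b : ℝ}
    (hA : ∀ i k, A i k ≤ b) : frob X A ≤ m * b := by
  have : frob X A ≤ ∑ i, ∑ k, X i k * b := by
    unfold frob
    gcongr with i _ k _
    · exact hX.1 i k
    · exact hA i k
  refine this.trans_eq ?_
  rw [Finset.sum_comm]
  simp [← Finset.sum_mul, hX.2]

lemma IsAllocation.frob_nonneg {X A : Mat n m} (hX : IsAllocation X)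
    (hA : ∀ i k, 0 ≤ A i k) : 0 ≤ frob X A :=
  Finset.sum_nonneg fun i _ => Finset.sum_nonneg fun k _ => mul_nonneg (hX.1 i k) (hA i k)

lemma frob_sub_right (X A B : Mat n m) :
    frob X (fun i k => A i k - B i k) = frob X A - frob X B := by
  simp [frob, mul_sub, Finset.sum_sub_distrib]

/-- The convex combination `(1 - δ) X + δ W`. -/
def mix (δ : ℝ) (X W : Mat n m) : Mat n m := fun i k => (1 - δ) * X i k + δ * W i k

lemma IsAllocation.mix {X W : Mat n m} (hX : IsAllocation X) (hW : IsAllocation W) {δ : ℝ}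
    (h0 : 0 ≤ δ) (h1 : δ ≤ 1) : IsAllocation (mix δ X W) := by
  refine ⟨fun i k => ?_, fun k => ?_⟩
  · have := hX.1 i k
    have := hW.1 i k
    have : 0 ≤ 1 - δ := by linarith
    unfold FairDivision.mix
    positivity
  · simp [FairDivision.mix, Finset.sum_add_distrib, ← Finset.mul_sum, hX.2, hW.2]

lemma slack_mix (μ X W : Mat n m) (δ : ℝ) (i l : Fin n) :
    slack μ (mix δ X W) i l = (1 - δ) * slack μ X i l + δ * slack μ W i l := by
  simp only [slack, mix, Finset.mul_sum, ← Finset.sum_add_distrib]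
  exact Finset.sum_congr rfl fun k _ => by ring

lemma frob_mix (μ X W : Mat n m) (δ : ℝ) :
    frob (mix δ X W) μ = (1 - δ) * frob X μ + δ * frob W μ := by
  simp only [frob, mix, Finset.mul_sum, ← Finset.sum_add_distrib]
  exact Finset.sum_congr rfl fun i _ => Finset.sum_congr rfl fun k _ => by ring

/-- Redistribution of the bundles with weights `p`. -/
def reshuffle (p : Fin n → Fin n → ℝ) (X : Mat n m) : Mat n m := fun i k => ∑ j, p i j * X j k

lemma IsAllocation.reshuffle {X : Mat n m} (hX : IsAllocation X) {p : Fin n → Fin n → ℝ}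
    (h0 : ∀ i j, 0 ≤ p i j) (h1 : ∀ j, ∑ i, p i j = 1) : IsAllocation (reshuffle p X) := by
  refine ⟨fun i k => Finset.sum_nonneg fun j _ => mul_nonneg (h0 i j) (hX.1 j k), fun k => ?_⟩
  simp only [FairDivision.reshuffle]
  rw [Finset.sum_comm]
  simp [← Finset.sum_mul, h1, hX.2]

lemma value_reshuffle (μ X : Mat n m) {p : Fin n → Fin n → ℝ} (h1 : ∀ i, ∑ j, p i j = 1)
    (i l : Fin n) :
    ∑ k, reshuffle p X l k * μ i k = ∑ k, X i k * μ i k - ∑ j, p l j * slack μ X i j := by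
  have h2 : ∑ k, X i k * μ i k = ∑ j, p l j * ∑ k, X i k * μ i k := by
    rw [← Finset.sum_mul, h1, one_mul]
  rw [h2, ← Finset.sum_sub_distrib]
  simp only [reshuffle, Finset.sum_mul]
  rw [Finset.sum_comm]
  refine Finset.sum_congr rfl fun j _ => ?_
  rw [← mul_sub, slack, ← Finset.sum_sub_distrib, Finset.mul_sum]
  exact Finset.sum_congr rfl fun k _ => by ring

/-- The second sum is what `i` loses by giving up her own bundle; it is small when row `i` of `p` is
supported on nearly tight pairs. The first sum is large as soon as the new bundle of `l` contains a
share of a bundle that `i` strongly dislikes. -/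
lemma slack_reshuffle (μ X : Mat n m) {p : Fin n → Fin n → ℝ} (h1 : ∀ i, ∑ j, p i j = 1)
    (i l : Fin n) :
    slack μ (reshuffle p X) i l = ∑ j, p l j * slack μ X i j - ∑ j, p i j * slack μ X i j := by
  have : slack μ (reshuffle p X) i l =
      ∑ k, reshuffle p X i k * μ i k - ∑ k, reshuffle p X l k * μ i k := by
    simp [slack, sub_mul, Finset.sum_sub_distrib]
  rw [this, value_reshuffle _ _ h1, value_reshuffle _ _ h1]
  ring

lemma frob_reshuffle (μ X : Mat n m) {p : Fin n → Fin n → ℝ} (h1 : ∀ i, ∑ j, p i j = 1) :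
    frob (reshuffle p X) μ = frob X μ - ∑ i, ∑ j, p i j * slack μ X i j := by
  simp only [frob, value_reshuffle _ _ h1, Finset.sum_sub_distrib]

end Allocations

/-! ### Doubly stochastic matrices from directed cycles. -/

section Circulation

variable {ι : Type*} [Fintype ι] [DecidableEq ι]

/-- A unit of flow is sent along a path, each edge counted with multiplicity; the net outflow
telescopes to source minus sink. -/
lemma exists_flow_of_reflTransGen {r : ι → ι → Prop} {x y : ι}
    (h : Relation.ReflTransGen r x y) :
    ∃ F : ι → ι → ℝ, (∀ u v, 0 ≤ F u v) ∧ (∀ u v, ¬ r u v → F u v = 0) ∧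
      ∀ z, ∑ w, F z w - ∑ w, F w z = (if z = x then 1 else 0) - (if z = y then 1 else 0) := by
  induction h with
  | refl => exact ⟨fun _ _ => 0, by simp, by simp, by simp⟩
  | @tail y y' _ hr ih =>
    obtain ⟨F, h0, h1, h2⟩ := ih
    refine ⟨fun u v => F u v + if u = y ∧ v = y' then 1 else 0, fun u v => ?_, fun u v huv => ?_,
      fun z => ?_⟩
    · have := h0 u v
      positivity
    · beta_reduce
      rw [h1 u v huv, if_neg, add_zero]
      rintro ⟨rfl, rfl⟩
      exact huv hr
    · have e1 : ∑ w, (if z = y ∧ w = y' then (1 : ℝ) else 0) = if z = y then 1 else 0 := by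
        by_cases hz : z = y <;> simp [hz]
      have e2 : ∑ w, (if w = y ∧ z = y' then (1 : ℝ) else 0) = if z = y' then 1 else 0 := by
        by_cases hz : z = y' <;> simp [hz]
      rw [Finset.sum_add_distrib, Finset.sum_add_distrib, e1, e2]
      linarith [h2 z]

/-- An edge on a directed cycle of a relation is in the support of a doubly stochastic matrix that
is supported on the relation and the diagonal. -/
lemma exists_doublyStochastic {r : ι → ι → Prop} (hr : ∀ x, r x x) {x y : ι} (hxy : r x y)
    (h : Relation.ReflTransGen r y x) :
    ∃ p : ι → ι → ℝ, (∀ u v, 0 ≤ p u v) ∧ (∀ u, ∑ v, p u v = 1) ∧ (∀ v, ∑ u, p u v = 1) ∧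
      (∀ u v, ¬ r u v → p u v = 0) ∧ (∀ u, 1 / 2 ≤ p u u) ∧ 0 < p x y := by
  obtain ⟨F, h0, h1, h2⟩ := exists_flow_of_reflTransGen h
  -- The edge from `x` to `y` closes the flow from `y` to `x` into a circulation. Scaled so that row
  -- sums are at most `1 / 2` and completed on the diagonal, it becomes doubly stochastic.
  set G : ι → ι → ℝ := fun u v => F u v + if u = x ∧ v = y then 1 else 0 with hG
  have G0 : ∀ u v, 0 ≤ G u v := fun u v => by
    have := h0 u v
    simp only [hG]
    positivity
  have Gbal : ∀ z, ∑ w, G z w = ∑ w, G w z := fun z => by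
    have e1 : ∑ w, (if z = x ∧ w = y then (1 : ℝ) else 0) = if z = x then 1 else 0 := by
      by_cases hz : z = x <;> simp [hz]
    have e2 : ∑ w, (if w = x ∧ z = y then (1 : ℝ) else 0) = if z = y then 1 else 0 := by
      by_cases hz : z = y <;> simp [hz]
    simp only [hG]
    rw [Finset.sum_add_distrib, Finset.sum_add_distrib, e1, e2]
    linarith [h2 z]
  set M : ℝ := ∑ u, ∑ v, G u v with hM
  have hM0 : 0 ≤ M := Finset.sum_nonneg fun u _ => Finset.sum_nonneg fun v _ => G0 u v
  have hout : ∀ u, ∑ v, G u v ≤ M := fun u =>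
    Finset.single_le_sum (f := fun u => ∑ v, G u v)
      (fun u _ => Finset.sum_nonneg fun v _ => G0 u v) (Finset.mem_univ u)
  set c : ℝ := 1 / (2 * M + 1) with hc
  have hc0 : 0 < c := by positivity
  have hcM : c * M ≤ 1 / 2 := by
    rw [hc, div_mul_eq_mul_div, div_le_iff₀ (by positivity)]
    linarith
  have hcout : ∀ u, c * ∑ v, G u v ≤ 1 / 2 := fun u =>
    (mul_le_mul_of_nonneg_left (hout u) hc0.le).trans hcM
  refine ⟨fun u v => (if u = v then 1 - c * ∑ w, G u w else 0) + c * G u v, fun u v => ?_,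
    fun u => ?_, fun v => ?_, fun u v huv => ?_, fun u => ?_, ?_⟩
  · have h3 := mul_nonneg hc0.le (G0 u v)
    have h4 := hcout u
    beta_reduce
    split_ifs <;> linarith
  · rw [Finset.sum_add_distrib, ← Finset.mul_sum]
    simp
  · rw [Finset.sum_add_distrib, ← Finset.mul_sum, ← Gbal]
    simp
  · have huv' : u ≠ v := fun e => huv (e ▸ hr u)
    have : ¬ (u = x ∧ v = y) := by
      rintro ⟨rfl, rfl⟩
      exact huv hxy
    simp [huv', hG, this, h1 u v huv]
  · have h3 := mul_nonneg hc0.le (G0 u u)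
    have h4 := hcout u
    simp only [if_true]
    linarith
  · have h3 : 1 ≤ G x y := by simp [hG, h0 x y]
    have h4 := hcout x
    have h5 : 0 < c * G x y := by positivity
    by_cases hxy' : x = y
    · simp only [hxy', if_true] at *
      linarith
    · simp only [hxy', if_false] at *
      linarith

end Circulation

/-! ### Separating bundles: the price of robust envy-freeness. -/

section Separation

variable {n m : ℕ}

/-- Any two bundles of `X` are equal or the owner of the first prefers it by at least `ε`. -/
def Separated (ε : ℝ) (μ X : Mat n m) : Prop := ∀ i l, X i = X l ∨ ε ≤ slack μ X i l

/-- Every allocation without envy above `ε` in which all the pairs outside of `R` have slack at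
least `K ε` can be made `ε`-separated at the cost `K ε`. -/
def SeparatesAt (n m : ℕ) (a b : ℝ) (R : Finset (Fin n × Fin n)) (K : ℝ) : Prop :=
  ∀ ε > 0, ∀ μ X : Mat n m, (∀ i k, a ≤ μ i k ∧ μ i k ≤ b) → IsAllocation X →
    (∀ i l, -ε ≤ slack μ X i l) → (∀ i l, (i, l) ∉ R → K * ε ≤ slack μ X i l) →
    ∃ X', IsAllocation X' ∧ Separated ε μ X' ∧ frob X μ - frob X' μ ≤ K * ε

lemma SeparatesAt.mono {a b : ℝ} {R : Finset (Fin n × Fin n)} {K K' : ℝ}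
    (h : SeparatesAt n m a b R K) (hK : K ≤ K') : SeparatesAt n m a b R K' := by
  intro ε hε μ X hμ hX h0 h1
  have hKε : K * ε ≤ K' * ε := by gcongr
  obtain ⟨X', h2, h3, h4⟩ := h ε hε μ X hμ hX h0 fun i l hil => hKε.trans (h1 i l hil)
  exact ⟨X', h2, h3, h4.trans hKε⟩

/-- Fallback for large `ε`: total welfare is at most `m * b`, so passing to UAR, whose bundles are
all equal, is affordable. -/
lemma exists_separated_of_le (hn : 0 < n) {a b c : ℝ} (ha : 0 < a) (ε : ℝ) {μ X : Mat n m}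
    (hμ : ∀ i k, a ≤ μ i k ∧ μ i k ≤ b) (hX : IsAllocation X) (hc : m * b ≤ c) :
    ∃ X', IsAllocation X' ∧ Separated ε μ X' ∧ frob X μ - frob X' μ ≤ c := by
  refine ⟨uar n m, isAllocation_uar hn, fun i l => Or.inl rfl, ?_⟩
  have h1 := hX.frob_le fun i k => (hμ i k).2
  have h2 := (isAllocation_uar (m := m) hn).frob_nonneg fun i k => ha.le.trans (hμ i k).1
  linarith

/-- A pair of `R` with slack above `K' * ε` can be moved out of `R`, where the smaller set already
has the constant `K'`. So only the case in which all of `R` is nearly tight needs an argument. -/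
lemma separatesAt_of_tight {a b : ℝ} {R : Finset (Fin n × Fin n)} {K K' : ℝ} (hK : K' ≤ K)
    (hR : ∀ e ∈ R, SeparatesAt n m a b (R.erase e) K')
    (h : ∀ ε > 0, ∀ μ X : Mat n m, (∀ i k, a ≤ μ i k ∧ μ i k ≤ b) → IsAllocation X →
      (∀ i l, -ε ≤ slack μ X i l) → (∀ i l, (i, l) ∉ R → K * ε ≤ slack μ X i l) →
      (∀ i l, (i, l) ∈ R → slack μ X i l ≤ K' * ε) →
      ∃ X', IsAllocation X' ∧ Separated ε μ X' ∧ frob X μ - frob X' μ ≤ K * ε) :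
    SeparatesAt n m a b R K := by
  intro ε hε μ X hμ hX h0 h1
  have hKε : K' * ε ≤ K * ε := by gcongr
  by_cases ht : ∀ i l, (i, l) ∈ R → slack μ X i l ≤ K' * ε
  · exact h ε hε μ X hμ hX h0 h1 ht
  · push Not at ht
    obtain ⟨i, l, hil, hs⟩ := ht
    obtain ⟨X', h2, h3, h4⟩ := hR _ hil ε hε μ X hμ hX h0 fun i' l' h' => by
      by_cases he : (i', l') = (i, l)
      · obtain ⟨rfl, rfl⟩ := Prod.mk.inj he
        exact hs.le
      · exact hKε.trans (h1 i' l' fun hmem => h' (Finset.mem_erase.2 ⟨he, hmem⟩))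
    exact ⟨X', h2, h3, h4.trans hKε⟩

/-- Everything is shared equally among the players of `S`. -/
noncomputable def shareAmong (m : ℕ) (S : Finset (Fin n)) : Mat n m :=
  fun i _ => if i ∈ S then 1 / (S.card : ℝ) else 0

lemma isAllocation_shareAmong {S : Finset (Fin n)} (hS : S.Nonempty) :
    IsAllocation (shareAmong m S) := by
  refine ⟨fun i k => ?_, fun k => ?_⟩
  · unfold shareAmong
    positivity
  · have : (S.card : ℝ) ≠ 0 := by exact_mod_cast hS.card_pos.ne'
    simp [shareAmong, this]

/-- Mix in a little of the allocation that shares everything among the players who reach `i₀` in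
`R`. No edge of `R` enters this set from outside, so this allocation has nonnegative slack on `R`,
and it has slack bounded below on `(i₀, l₀)`, which can then leave `R`. Pairs outside `R` have
enough slack to absorb the change. -/
lemma exists_separatesAt_of_not_reach (hn : 0 < n) (hm : 0 < m) {a b : ℝ} (ha : 0 < a)
    (hab : a ≤ b)
    {R : Finset (Fin n × Fin n)} {K' : ℝ} (hK' : 1 ≤ K')
    (hR : ∀ e ∈ R, SeparatesAt n m a b (R.erase e) K') {i₀ l₀ : Fin n} (h₀ : (i₀, l₀) ∈ R)
    (hreach : ¬ Relation.ReflTransGen (fun x y => (x, y) ∈ R) l₀ i₀) :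
    ∃ K, SeparatesAt n m a b R K := by
  classical
  set S : Finset (Fin n) :=
    Finset.univ.filter fun j => Relation.ReflTransGen (fun x y => (x, y) ∈ R) j i₀ with hS
  have hi₀ : i₀ ∈ S := by simp [hS, Relation.ReflTransGen.refl]
  have hl₀ : l₀ ∉ S := by simp [hS, hreach]
  have hclosed : ∀ x y, (x, y) ∈ R → y ∈ S → x ∈ S := by
    intro x y hxy hy
    simp only [hS, Finset.mem_filter, Finset.mem_univ, true_and] at hy ⊢
    exact Relation.ReflTransGen.head hxy hy
  have hW := isAllocation_shareAmong (m := m) ⟨i₀, hi₀⟩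
  have hn' : (0 : ℝ) < n := by exact_mod_cast hn
  have hm' : (0 : ℝ) < m := by exact_mod_cast hm
  have hb : 0 < b := ha.trans_le hab
  set g : ℝ := a * m / n with hg
  have hg0 : 0 < g := by positivity
  set K : ℝ := 2 * K' + 2 * ((K' + 1) / g) * (m * b) with hK
  have hKK : K' ≤ K := by
    have : 0 ≤ 2 * ((K' + 1) / g) * (m * b) := by positivity
    linarith
  refine ⟨K, separatesAt_of_tight hKK hR fun ε hε μ X hμ hX h0 h1 _ => ?_⟩
  have hμ0 : ∀ i k, 0 ≤ μ i k := fun i k => ha.le.trans (hμ i k).1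
  set δ : ℝ := (K' + 1) / g * ε with hδ
  have hδ0 : 0 < δ := by positivity
  have hKε : K * ε = 2 * (K' * ε) + 2 * δ * (m * b) := by rw [hK, hδ]; ring
  have hKε0 : 0 < K' * ε := by positivity
  have hmb : 0 < m * b := by positivity
  by_cases hδ1 : 1 / 2 < δ
  · refine exists_separated_of_le hn ha ε hμ hX ?_
    rw [hKε]
    nlinarith
  push Not at hδ1
  have hgδ : δ * g = (K' + 1) * ε := by rw [hδ]; field_simp
  set W := shareAmong m S with hWdef
  have sW_same : ∀ i l, (l ∈ S → i ∈ S) → 0 ≤ slack μ W i l := by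
    intro i l hil
    refine Finset.sum_nonneg fun k _ => mul_nonneg ?_ (hμ0 i k)
    by_cases hl : l ∈ S
    · simp [hWdef, shareAmong, hl, hil hl]
    · have := hW.1 i k
      simpa [hWdef, shareAmong, hl] using this
  have sW_ge : ∀ i l, -(m * b) ≤ slack μ W i l := by
    intro i l
    have : ∑ _k : Fin m, -b ≤ slack μ W i l := by
      refine Finset.sum_le_sum fun k _ => ?_
      have h3 := hW.1 i k
      have h4 := hW.le_one l k
      have h5 := hμ i k
      have h6 := hμ0 i k
      nlinarith
    simpa using this
  have sW_out : g ≤ slack μ W i₀ l₀ := by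
    have hcard : (S.card : ℝ) ≤ n := by
      have := S.card_le_univ
      simp only [Fintype.card_fin] at this
      exact_mod_cast this
    have hcard0 : (0 : ℝ) < S.card := by exact_mod_cast Finset.card_pos.2 ⟨i₀, hi₀⟩
    have : ∑ _k : Fin m, (1 / (n : ℝ)) * a ≤ slack μ W i₀ l₀ := by
      refine Finset.sum_le_sum fun k _ => ?_
      simp only [hWdef, shareAmong, hi₀, hl₀, if_true, if_false, sub_zero]
      gcongr
      exact (hμ i₀ k).1
    refine le_trans (le_of_eq ?_) this
    rw [hg]
    simp
    ring
  have hX' : IsAllocation (mix δ X W) := hX.mix hW hδ0.le (by linarith)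
  have hKmul : K' * ε ≤ (1 - δ) * (K * ε) - δ * (m * b) := by
    have h3 : 0 ≤ K * ε := by rw [hKε]; positivity
    have h4 : (1 / 2) * (K * ε) ≤ (1 - δ) * (K * ε) := by gcongr; linarith
    rw [hKε] at h4 ⊢
    linarith
  obtain ⟨X'', h2, h3, h4⟩ := hR _ h₀ ε hε μ (mix δ X W) hμ hX' (fun i l => by
      rw [slack_mix]
      by_cases hil : l ∈ S → i ∈ S
      · have h5 := mul_nonneg hδ0.le (sW_same i l hil)
        have h6 : (1 - δ) * (-ε) ≤ (1 - δ) * slack μ X i l :=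
          mul_le_mul_of_nonneg_left (h0 i l) (by linarith)
        nlinarith
      · have hnot : (i, l) ∉ R := fun hmem => hil fun hl => hclosed i l hmem hl
        have h5 : (1 - δ) * (K * ε) ≤ (1 - δ) * slack μ X i l :=
          mul_le_mul_of_nonneg_left (h1 i l hnot) (by linarith)
        have h6 : δ * (-(m * b)) ≤ δ * slack μ W i l :=
          mul_le_mul_of_nonneg_left (sW_ge i l) hδ0.le
        linarith)
    (fun i l hil => by
      rw [slack_mix]
      by_cases he : (i, l) = (i₀, l₀)
      · obtain ⟨rfl, rfl⟩ := Prod.mk.inj he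
        have h5 : δ * g ≤ δ * slack μ W i l := mul_le_mul_of_nonneg_left sW_out hδ0.le
        have h6 : (1 - δ) * (-ε) ≤ (1 - δ) * slack μ X i l :=
          mul_le_mul_of_nonneg_left (h0 i l) (by linarith)
        nlinarith
      · have hnot : (i, l) ∉ R := fun hmem => hil (Finset.mem_erase.2 ⟨he, hmem⟩)
        have h5 : (1 - δ) * (K * ε) ≤ (1 - δ) * slack μ X i l :=
          mul_le_mul_of_nonneg_left (h1 i l hnot) (by linarith)
        have h6 : δ * (-(m * b)) ≤ δ * slack μ W i l :=
          mul_le_mul_of_nonneg_left (sW_ge i l) hδ0.le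
        linarith)
  refine ⟨X'', h2, h3, ?_⟩
  have h5 := hX.frob_le fun i k => (hμ i k).2
  have h6 := mul_nonneg hδ0.le (hW.frob_nonneg hμ0)
  have h7 : δ * frob X μ ≤ δ * (m * b) := mul_le_mul_of_nonneg_left h5 hδ0.le
  have h8 := frob_mix μ X W δ
  have h9 : 0 < δ * (m * b) := by positivity
  rw [hKε]
  linarith

section Reshuffle

variable {μ X : Mat n m} {p : Fin n → Fin n → ℝ} {R : Finset (Fin n × Fin n)} {ε η : ℝ}

lemma sum_reshuffle_le (h0 : ∀ i j, 0 ≤ p i j) (h1 : ∀ i, ∑ j, p i j = 1)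
    (hp : ∀ i j, (i, j) ∉ R → p i j = 0) (hη : ∀ i j, (i, j) ∈ R → slack μ X i j ≤ η)
    (i : Fin n) : ∑ j, p i j * slack μ X i j ≤ η := by
  have : ∑ j, p i j * slack μ X i j ≤ ∑ j, p i j * η := by
    refine Finset.sum_le_sum fun j _ => ?_
    by_cases hij : (i, j) ∈ R
    · exact mul_le_mul_of_nonneg_left (hη i j hij) (h0 i j)
    · simp [hp i j hij]
  rwa [← Finset.sum_mul, h1, one_mul] at this

lemma le_sum_reshuffle (h0 : ∀ i j, 0 ≤ p i j) (h1 : ∀ i, ∑ j, p i j = 1)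
    (hε : ∀ i j, -ε ≤ slack μ X i j) (i l : Fin n) :
    -ε ≤ ∑ j, p l j * slack μ X i j := by
  have : ∑ j, p l j * (-ε) ≤ ∑ j, p l j * slack μ X i j :=
    Finset.sum_le_sum fun j _ => mul_le_mul_of_nonneg_left (hε i j) (h0 l j)
  rwa [← Finset.sum_mul, h1, one_mul] at this

lemma le_sum_reshuffle_of_le {c : ℝ} (h0 : ∀ i j, 0 ≤ p i j) (h1 : ∀ i, ∑ j, p i j = 1)
    (hε0 : 0 ≤ ε) (hε : ∀ i j, -ε ≤ slack μ X i j) (i l j₀ : Fin n) (hc : c ≤ slack μ X i j₀) :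
    p l j₀ * c - ε ≤ ∑ j, p l j * slack μ X i j := by
  have h2 : ∑ j, (p l j * (-ε) + if j = j₀ then p l j * c else 0) ≤
      ∑ j, p l j * slack μ X i j := by
    refine Finset.sum_le_sum fun j _ => ?_
    have h3 := mul_le_mul_of_nonneg_left (hε i j) (h0 l j)
    by_cases hj : j = j₀
    · subst hj
      have h4 := mul_le_mul_of_nonneg_left hc (h0 l j)
      have h5 := mul_nonneg (h0 l j) hε0
      simp only [if_true]
      linarith
    · simpa [hj] using h3
  rw [Finset.sum_add_distrib, ← Finset.sum_mul, h1] at h2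
  simp at h2
  linarith

end Reshuffle

/-- Rotate along a cycle through `(l₀, j₀)`. Then `l₀` receives a share of the bundle of `j₀`,
against which `i₀` has large slack because `(i₀, j₀)` is outside `R`; hence `(i₀, l₀)` gains slack
and can leave `R`. The diagonal weights of at least `1 / 2` keep the slack of pairs outside `R`
large. -/
lemma exists_separatesAt_of_not_trans {a b : ℝ}
    {R : Finset (Fin n × Fin n)} {K' : ℝ} (hK' : 1 ≤ K')
    (hR : ∀ e ∈ R, SeparatesAt n m a b (R.erase e) K') (hrefl : ∀ i, (i, i) ∈ R)
    {i₀ l₀ j₀ : Fin n} (h₀ : (i₀, l₀) ∈ R) (h₀' : (l₀, j₀) ∈ R) (h₀'' : (i₀, j₀) ∉ R)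
    (hreach : Relation.ReflTransGen (fun x y => (x, y) ∈ R) j₀ l₀) :
    ∃ K, SeparatesAt n m a b R K := by
  obtain ⟨p, p0, p1, p2, p3, p4, p5⟩ :=
    exists_doublyStochastic (r := fun x y => (x, y) ∈ R) hrefl h₀' hreach
  set q := p l₀ j₀ with hq
  -- The three terms pay for the slack lost by rotating, the welfare lost by rotating, and the slack
  -- and cost `K' * (2 * K' * ε)` of the inductive call. The factor `2 + 1 / q` in `K` makes both `q
  -- * K` and `K / 2` at least `A`.
  set A : ℝ := 2 * K' + n * K' + 2 * K' ^ 2 with hA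
  have hA0 : 0 ≤ A := by positivity
  set K : ℝ := A * (2 + 1 / q) with hK
  have hKA : 2 * A ≤ K := by
    have : 0 ≤ A * (1 / q) := by positivity
    linarith
  have hqK : A ≤ q * K := by
    have : q * K = A + 2 * q * A := by rw [hK]; field_simp; ring
    have : 0 ≤ 2 * q * A := by positivity
    linarith
  have hA2 : 2 * K' + 2 * K' ^ 2 ≤ A := by
    have : 0 ≤ n * K' := by positivity
    linarith
  refine ⟨K, separatesAt_of_tight (by nlinarith) hR fun ε hε μ X hμ hX h0 h1 ht => ?_⟩
  have hε' : ε ≤ K' * ε := by nlinarith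
  have hup := sum_reshuffle_le p0 p1 p3 ht
  have hlow : ∀ i l j c, c ≤ slack μ X i j → p l j * c - 2 * (K' * ε) ≤
      slack μ (reshuffle p X) i l := fun i l j c hc => by
    have h2 := le_sum_reshuffle_of_le p0 p1 hε.le h0 i l j hc
    have h3 := hup i
    rw [slack_reshuffle _ _ p1]
    linarith
  have hkey : ∀ x, A ≤ x * K → K' * (2 * K' * ε) ≤ x * (K * ε) - 2 * (K' * ε) := fun x hx => by
    have : A * ε ≤ x * K * ε := by gcongr
    have : (2 * K' + 2 * K' ^ 2) * ε ≤ A * ε := by gcongr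
    linarith
  have hK0 : 0 ≤ K := by linarith
  -- Rotation may create envy up to `ε + K' * ε`, so the induction hypothesis is applied with a
  -- larger `ε`.
  obtain ⟨X'', h2, h3, h4⟩ := hR _ h₀ (2 * K' * ε) (by positivity) μ (reshuffle p X) hμ
    (hX.reshuffle p0 p2) (fun i l => by
      have h2 := le_sum_reshuffle p0 p1 h0 i l
      have h3 := hup i
      rw [slack_reshuffle _ _ p1]
      linarith)
    (fun i l hil => by
      by_cases he : (i, l) = (i₀, l₀)
      · obtain ⟨rfl, rfl⟩ := Prod.mk.inj he
        exact (hkey _ hqK).trans (hlow i l j₀ _ (h1 _ _ h₀''))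
      · have hnot : (i, l) ∉ R := fun hmem => hil (Finset.mem_erase.2 ⟨he, hmem⟩)
        exact (hkey (p l l) (by nlinarith [p4 l])).trans (hlow i l l _ (h1 _ _ hnot)))
  refine ⟨X'', h2, fun i l => (h3 i l).imp_right fun h => ?_, ?_⟩
  · linarith
  · have h5 := frob_reshuffle μ X p1
    have h6 : ∑ i, ∑ j, p i j * slack μ X i j ≤ ∑ _i : Fin n, K' * ε :=
      Finset.sum_le_sum fun i _ => hup i
    simp only [Finset.sum_const, Finset.card_univ, Fintype.card_fin, nsmul_eq_mul] at h6
    have h7 : (n * K' + 2 * K' ^ 2) * ε ≤ K * ε := by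
      gcongr
      linarith
    linarith

/-- Averaging within each class makes bundles inside a class equal. Across classes, every bundle
keeps a share of at least `1 / n` of itself, so the large slacks survive. Tightness inside the
classes bounds the welfare loss. -/
lemma separatesAt_of_equivalence {a b : ℝ} {R : Finset (Fin n × Fin n)} {K' : ℝ} (hK' : 1 ≤ K')
    (hR : ∀ e ∈ R, SeparatesAt n m a b (R.erase e) K')
    (hequiv : Equivalence fun x y => (x, y) ∈ R) :
    ∃ K, SeparatesAt n m a b R K := by
  classical
  set cl : Fin n → Finset (Fin n) := fun i => Finset.univ.filter fun j => (i, j) ∈ R with hcl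
  have mem_cl : ∀ i j, j ∈ cl i ↔ (i, j) ∈ R := by simp [hcl]
  have cl_eq : ∀ i j, (i, j) ∈ R → cl i = cl j := by
    intro i j hij
    ext x
    rw [mem_cl, mem_cl]
    exact ⟨fun h => hequiv.trans (hequiv.symm hij) h, fun h => hequiv.trans hij h⟩
  have cl_pos : ∀ i, (0 : ℝ) < (cl i).card := fun i => by
    exact_mod_cast Finset.card_pos.2 ⟨i, (mem_cl i i).2 (hequiv.refl i)⟩
  set p : Fin n → Fin n → ℝ := fun i j => if j ∈ cl i then 1 / ((cl i).card : ℝ) else 0 with hp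
  have p0 : ∀ i j, 0 ≤ p i j := fun i j => by
    simp only [hp]
    positivity
  have p1 : ∀ i, ∑ j, p i j = 1 := fun i => by
    have := (cl_pos i).ne'
    simp [hp, this]
  have psymm : ∀ i j, p i j = p j i := by
    intro i j
    by_cases hij : (i, j) ∈ R
    · have h2 := (mem_cl i j).2 hij
      have h3 := (mem_cl j i).2 (hequiv.symm hij)
      rw [cl_eq i j hij] at h2
      simp only [hp, h2, h3, if_true, cl_eq i j hij]
    · have h2 : j ∉ cl i := fun h => hij ((mem_cl i j).1 h)
      have h3 : i ∉ cl j := fun h => hij (hequiv.symm ((mem_cl j i).1 h))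
      simp only [hp, h2, h3, if_false]
  have p2 : ∀ j, ∑ i, p i j = 1 := fun j => by
    simp_rw [psymm _ j]
    exact p1 j
  have p3 : ∀ i j, (i, j) ∉ R → p i j = 0 := fun i j hij => by
    simp [hp, mem_cl, hij]
  have p4 : ∀ i, 1 ≤ n * p i i := fun i => by
    have h2 := (mem_cl i i).2 (hequiv.refl i)
    have h3 : ((cl i).card : ℝ) ≤ n := by
      have := (cl i).card_le_univ
      simp only [Fintype.card_fin] at this
      exact_mod_cast this
    simp only [hp, h2, if_true, mul_one_div]
    rwa [one_le_div (cl_pos i)]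
  set K : ℝ := (2 + K') * (n + 1) with hK
  have hKK : K' ≤ K := by
    have : 0 ≤ (2 + K') * n := by positivity
    linarith
  refine ⟨K, separatesAt_of_tight hKK hR fun ε hε μ X hμ hX h0 h1 ht => ?_⟩
  have hup := sum_reshuffle_le p0 p1 p3 ht
  refine ⟨reshuffle p X, hX.reshuffle p0 p2, fun i l => ?_, ?_⟩
  · by_cases hil : (i, l) ∈ R
    · left
      ext k
      simp only [reshuffle, hp, cl_eq i l hil]
    · right
      have h2 := le_sum_reshuffle_of_le p0 p1 hε.le h0 i l l (h1 i l hil)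
      have h3 := hup i
      have h4 : (2 + K') * ε ≤ p l l * (K * ε) := by
        have h5 : 2 + K' ≤ p l l * K := by
          rw [hK]
          nlinarith [p4 l, p0 l l]
        nlinarith
      rw [slack_reshuffle _ _ p1]
      linarith
  · have h5 := frob_reshuffle μ X p1
    have h6 : ∑ i, ∑ j, p i j * slack μ X i j ≤ ∑ _i : Fin n, K' * ε :=
      Finset.sum_le_sum fun i _ => hup i
    simp only [Finset.sum_const, Finset.card_univ, Fintype.card_fin, nsmul_eq_mul] at h6
    have h7 : n * K' * ε ≤ K * ε := by
      gcongr
      rw [hK]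
      nlinarith
    linarith

/-- Only `R = Finset.univ` is used later, where the condition on pairs outside `R` is void. The
constant depends only on `R` and the data `n`, `m`, `a`, `b`, since the case distinction concerns
`R` and not the allocation. -/
theorem exists_separatesAt (hn : 0 < n) (hm : 0 < m) {a b : ℝ} (ha : 0 < a) (hab : a ≤ b)
    (R : Finset (Fin n × Fin n)) : ∃ K, SeparatesAt n m a b R K := by
  induction R using Finset.strongInduction with
  | H R ih =>
  have ih' : ∀ e, ∃ K, e ∈ R → SeparatesAt n m a b (R.erase e) K := fun e => by
    by_cases he : e ∈ R
    · exact (ih _ (Finset.erase_ssubset he)).imp fun K h _ => h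
    · exact ⟨0, fun h => absurd h he⟩
  choose Ke hKe using ih'
  set K' : ℝ := 1 + ∑ e, |Ke e| with hK'def
  have hK' : 1 ≤ K' := by
    have : 0 ≤ ∑ e, |Ke e| := Finset.sum_nonneg fun e _ => abs_nonneg _
    linarith
  have hR : ∀ e ∈ R, SeparatesAt n m a b (R.erase e) K' := fun e he => (hKe e he).mono (by
    have h1 := Finset.single_le_sum (f := fun e => |Ke e|) (fun e _ => abs_nonneg _)
      (Finset.mem_univ e)
    have h2 := le_abs_self (Ke e)
    linarith)
  by_cases hrefl : ∀ i, (i, i) ∈ R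
  swap
  · push Not at hrefl
    obtain ⟨i, hi⟩ := hrefl
    -- Vacuous: a diagonal pair outside `R` would need positive slack, but its slack is zero.
    refine ⟨1, fun ε hε μ X _ _ _ h1 => ?_⟩
    have := h1 i i hi
    rw [slack_self] at this
    linarith
  by_cases hreach : ∃ i l, (i, l) ∈ R ∧ ¬ Relation.ReflTransGen (fun x y => (x, y) ∈ R) l i
  · obtain ⟨i, l, hil, h⟩ := hreach
    exact exists_separatesAt_of_not_reach hn hm ha hab hK' hR hil h
  push Not at hreach
  by_cases htrans : ∀ i l j, (i, l) ∈ R → (l, j) ∈ R → (i, j) ∈ R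
  · refine separatesAt_of_equivalence hK' hR ⟨hrefl, fun {i l} hil => ?_, fun h h' =>
      htrans _ _ _ h h'⟩
    have key : ∀ x y, Relation.ReflTransGen (fun x y => (x, y) ∈ R) x y → (x, y) ∈ R := by
      intro x y h
      induction h with
      | refl => exact hrefl x
      | tail _ h1 h2 => exact htrans _ _ _ h2 h1
    exact key _ _ (hreach i l hil)
  · push Not at htrans
    obtain ⟨i, l, j, h1, h2, h3⟩ := htrans
    exact exists_separatesAt_of_not_trans hK' hR hrefl h1 h2 h3 (hreach l j h2)

end Separation

/-! ### Fairness constraints as slacks, proportionality, and the price of robustness. -/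

variable {n m : ℕ}

lemma frob_efConstraints (μ X : Mat n m) (l : Fin n × Fin n) :
    frob ((efConstraints n m).B l μ) X = slack μ X l.1 l.2 := by
  simp only [frob, efConstraints, slack, sub_mul, Finset.sum_sub_distrib, ite_mul, zero_mul]
  rw [Finset.sum_comm, Finset.sum_comm (f := fun i k => if i = l.2 then _ else _)]
  simp [mul_comm]

/-- The amount by which player `i` prefers her bundle to the average bundle. -/
noncomputable def propSlack (μ X : Mat n m) (i : Fin n) : ℝ :=
  ∑ k, (X i k - 1 / (n : ℝ)) * μ i k

lemma frob_propConstraints (μ : Mat n m) {X : Mat n m} (hX : IsAllocation X) (l : Fin n) :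
    frob ((propConstraints n m).B l μ) X = propSlack μ X l := by
  have hn : (n : ℝ) ≠ 0 := by
    have := l.pos
    positivity
  simp only [frob, propConstraints, propSlack]
  rw [Finset.sum_comm]
  refine Finset.sum_congr rfl fun k _ => ?_
  have h1 : ∀ i : Fin n, (if i = l then ((n : ℝ) - 1) / n * μ l k else -(1 / (n : ℝ)) * μ l k)
      * X i k = (if i = l then μ l k * X i k else 0) - 1 / (n : ℝ) * μ l k * X i k := by
    intro i
    split_ifs
    · field_simp
    · ring
  simp_rw [h1]
  rw [Finset.sum_sub_distrib, ← Finset.mul_sum, hX.2 k]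
  simp
  ring

lemma sat_efConstraints {μ X : Mat n m} :
    (efConstraints n m).Sat μ X ↔ ∀ i l, 0 ≤ slack μ X i l := by
  exact ⟨fun h i l => (h (i, l)).trans_eq (frob_efConstraints μ X (i, l)),
    fun h l => (h l.1 l.2).trans_eq (frob_efConstraints μ X l).symm⟩

lemma sat_propConstraints {μ X : Mat n m} (hX : IsAllocation X) :
    (propConstraints n m).Sat μ X ↔ ∀ i, 0 ≤ propSlack μ X i := by
  exact ⟨fun h i => (h i).trans_eq (frob_propConstraints μ hX i),
    fun h i => (h i).trans_eq (frob_propConstraints μ hX i).symm⟩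

lemma sat_uar {𝒞 : ConstraintFamily n m} (hn : 0 < n)
    (h𝒞 : 𝒞 = efConstraints n m ∨ 𝒞 = propConstraints n m) (μ : Mat n m) :
    𝒞.Sat μ (uar n m) := by
  rcases h𝒞 with rfl | rfl
  · exact sat_efConstraints.2 fun i l => (slack_of_eq rfl).ge
  · exact (sat_propConstraints (isAllocation_uar hn)).2 fun i => by simp [propSlack, uar]

lemma sum_mul_le_sum_mul_add {x μ μ' : Fin m → ℝ} {r : ℝ} (hx : ∀ k, |x k| ≤ 1)
    (h : ∀ k, |μ' k - μ k| ≤ r) : ∑ k, x k * μ k ≤ ∑ k, x k * μ' k + m * r := by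
  have h1 : ∑ k, x k * μ k ≤ ∑ k, (x k * μ' k + r) := by
    refine Finset.sum_le_sum fun k _ => ?_
    have h2 : |x k * (μ' k - μ k)| ≤ 1 * r := by
      rw [abs_mul]
      exact mul_le_mul (hx k) (h k) (abs_nonneg _) zero_le_one
    have h3 := neg_abs_le (x k * (μ' k - μ k))
    linarith
  simpa [Finset.sum_add_distrib] using h1

lemma slack_le_slack_add {μ μ' X : Mat n m} {r : ℝ} (hX : IsAllocation X)
    (h : ∀ i k, |μ' i k - μ i k| ≤ r) (i l : Fin n) :
    slack μ X i l ≤ slack μ' X i l + m * r :=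
  sum_mul_le_sum_mul_add (fun k => abs_le.2
    ⟨by linarith [hX.1 i k, hX.le_one l k], by linarith [hX.1 l k, hX.le_one i k]⟩) (h i)

lemma propSlack_le_propSlack_add {μ μ' X : Mat n m} {r : ℝ} (hX : IsAllocation X)
    (h : ∀ i k, |μ' i k - μ i k| ≤ r) (i : Fin n) :
    propSlack μ X i ≤ propSlack μ' X i + m * r := by
  have hn : 1 / (n : ℝ) ≤ 1 := by
    have : (1 : ℝ) ≤ n := by exact_mod_cast i.pos
    rw [div_le_one (by linarith)]
    exact this
  have hn0 : 0 ≤ 1 / (n : ℝ) := by positivity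
  exact sum_mul_le_sum_mul_add (fun k => abs_le.2
    ⟨by linarith [hX.1 i k], by linarith [hX.le_one i k]⟩) (h i)

lemma propSlack_mix (μ X W : Mat n m) (δ : ℝ) (i : Fin n) :
    propSlack μ (mix δ X W) i = (1 - δ) * propSlack μ X i + δ * propSlack μ W i := by
  simp only [propSlack, mix, Finset.mul_sum, ← Finset.sum_add_distrib]
  exact Finset.sum_congr rfl fun k _ => by ring

lemma sum_propSlack (μ X : Mat n m) :
    ∑ i, propSlack μ X i = frob X μ - frob (uar n m) μ := by
  simp only [propSlack, frob, uar, sub_mul, Finset.sum_sub_distrib]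

/-- Every proportional allocation can be given slack `ε`, or replaced by the uniform-at-random
allocation, at a cost of the order `ε`. -/
theorem exists_propSlack_le (hn : 0 < n) (hm : 0 < m) {a b : ℝ} (ha : 0 < a) (hab : a ≤ b) :
    ∃ K : ℝ, ∀ ε > 0, ∀ μ X : Mat n m, (∀ i k, a ≤ μ i k ∧ μ i k ≤ b) → IsAllocation X →
      (∀ i, 0 ≤ propSlack μ X i) → ∃ X', IsAllocation X' ∧
        (X' = uar n m ∨ ∀ i, ε ≤ propSlack μ X' i) ∧ frob X μ - frob X' μ ≤ K * ε := by
  have hn' : (0 : ℝ) < n := by exact_mod_cast hn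
  have hm' : (0 : ℝ) < m := by exact_mod_cast hm
  have hb : 0 < b := ha.trans_le hab
  set g : ℝ := a * m / (n * n) with hg
  have hg0 : 0 < g := by positivity
  -- If UAR costs more than `K * ε`, some player `j` has proportional slack at least `2 * ε + 2 * δ
  -- * (m * b)`. Half of it survives the mixing, and subtracting the loss `δ * (m * b)` leaves `ε`.
  -- The others gain `δ * g = ε`.
  set K : ℝ := n * (2 + 2 * (m * b) / g) with hK
  have hKε : ∀ ε, K * ε = n * (2 * ε + 2 * (ε / g) * (m * b)) := fun ε => by rw [hK]; ring
  refine ⟨K, fun ε hε μ X hμ hX h0 => ?_⟩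
  have hμ0 : ∀ i k, 0 ≤ μ i k := fun i k => ha.le.trans (hμ i k).1
  have hu := isAllocation_uar (m := m) hn
  by_cases hU : frob X μ - frob (uar n m) μ ≤ K * ε
  · exact ⟨uar n m, hu, Or.inl rfl, hU⟩
  push Not at hU
  have hfX := hX.frob_le fun i k => (hμ i k).2
  have hfu := hu.frob_nonneg hμ0
  set δ := ε / g with hδ
  have hδ0 : 0 < δ := by positivity
  have hδg : δ * g = ε := by rw [hδ]; field_simp
  have hmb : 0 < m * b := by positivity
  have hn1 : (1 : ℝ) ≤ n := by exact_mod_cast hn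
  have hδb : 0 < δ * (m * b) := by positivity
  have hKge : 2 * ε + 2 * δ * (m * b) ≤ K * ε := by
    rw [hKε]
    nlinarith
  have hδ1 : δ ≤ 1 / 2 := by
    by_contra hcon
    push Not at hcon
    nlinarith
  obtain ⟨j, -, hj⟩ : ∃ j ∈ Finset.univ, 2 * ε + 2 * δ * (m * b) ≤ propSlack μ X j := by
    refine Finset.exists_le_of_sum_le ⟨⟨0, hn⟩, Finset.mem_univ _⟩ ?_
    rw [sum_propSlack]
    simp only [Finset.sum_const, Finset.card_univ, Fintype.card_fin, nsmul_eq_mul]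
    rw [← hKε]
    exact hU.le
  -- A single player would make UAR the only allocation, contradicting its large cost.
  have hn2 : (Finset.univ.erase j).Nonempty := by
    by_contra hne
    rw [Finset.not_nonempty_iff_eq_empty] at hne
    have hone : ∀ i, i = j := fun i => by
      by_contra hi
      have : i ∈ Finset.univ.erase j := Finset.mem_erase.2 ⟨hi, Finset.mem_univ i⟩
      simp [hne] at this
    have h2 : frob X μ = frob (uar n m) μ := by
      unfold frob
      refine Finset.sum_congr rfl fun i _ => Finset.sum_congr rfl fun k _ => ?_
      have h3 := hX.2 k
      have h4 := hu.2 k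
      have huniv : (Finset.univ : Finset (Fin n)) = {i} := by
        ext x
        simp [hone x, hone i]
      rw [huniv, Finset.sum_singleton] at h3 h4
      rw [h3, h4]
    have : 0 < K * ε := by linarith
    linarith
  have hW := isAllocation_shareAmong (m := m) hn2
  set W := shareAmong m (Finset.univ.erase j) with hWdef
  have hcard : ((Finset.univ.erase j).card : ℝ) = n - 1 := by
    rw [Finset.card_erase_of_mem (Finset.mem_univ j)]
    simp [Nat.cast_sub (show 1 ≤ n from hn)]
  have hcard0 : (0 : ℝ) < n - 1 := by
    rw [← hcard]
    exact_mod_cast hn2.card_pos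
  have hWi : ∀ i, i ≠ j → g ≤ propSlack μ W i := by
    intro i hi
    have : ∑ _k : Fin m, (1 / ((n : ℝ) * n)) * a ≤ propSlack μ W i := by
      refine Finset.sum_le_sum fun k _ => ?_
      have : 1 / ((n : ℝ) * n) ≤ 1 / ((n : ℝ) - 1) - 1 / n := by
        rw [div_sub_div _ _ hcard0.ne' hn'.ne', div_le_div_iff₀ (by positivity) (by positivity)]
        nlinarith
      simp only [hWdef, shareAmong, Finset.mem_erase, hi, Finset.mem_univ, ne_eq,
        not_false_eq_true, and_self, if_true, hcard]
      exact mul_le_mul this (hμ i k).1 ha.le (this.trans' (by positivity))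
    refine le_trans (le_of_eq ?_) this
    rw [hg]
    simp
    ring
  have hWj : -(m * b) ≤ propSlack μ W j := by
    have : ∑ _k : Fin m, -b ≤ propSlack μ W j := by
      refine Finset.sum_le_sum fun k _ => ?_
      have h3 := hW.1 j k
      have h4 : 1 / (n : ℝ) ≤ 1 := by rwa [div_le_one hn']
      have h5 := hμ j k
      have h6 := hμ0 j k
      nlinarith
    simpa using this
  refine ⟨mix δ X W, hX.mix hW hδ0.le (by linarith), Or.inr fun i => ?_, ?_⟩
  · rw [propSlack_mix]
    by_cases hi : i = j
    · subst hi
      have h3 := mul_le_mul_of_nonneg_left hWj hδ0.le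
      have h4 : (1 / 2) * propSlack μ X i ≤ (1 - δ) * propSlack μ X i :=
        mul_le_mul_of_nonneg_right (by linarith) (h0 i)
      linarith
    · have h3 := mul_le_mul_of_nonneg_left (hWi i hi) hδ0.le
      have h4 : 0 ≤ (1 - δ) * propSlack μ X i := mul_nonneg (by linarith) (h0 i)
      linarith
  · rw [frob_mix]
    have h3 := mul_nonneg hδ0.le (hW.frob_nonneg hμ0)
    have h4 := mul_le_mul_of_nonneg_left hfX hδ0.le
    linarith

/-- The price of robustness: the best fair allocation can be made fair for all mean matrices at
distance at most `r` at a cost of the order `r`. -/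
theorem exists_robust (hn : 0 < n) (hm : 0 < m) {a b : ℝ} (ha : 0 < a) (hab : a ≤ b)
    {𝒞 : ConstraintFamily n m} (h𝒞 : 𝒞 = efConstraints n m ∨ 𝒞 = propConstraints n m) :
    ∃ K : ℝ, 0 ≤ K ∧ ∀ r > 0, ∀ μ Y : Mat n m, (∀ i k, a ≤ μ i k ∧ μ i k ≤ b) →
      Y ∈ fairSet 𝒞 μ → ∃ X', IsAllocation X' ∧
        (∀ μ' : Mat n m, (∀ i k, |μ' i k - μ i k| ≤ r) → 𝒞.Sat μ' X') ∧
        frob Y μ - frob X' μ ≤ K * r := by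
  have hm' : (0 : ℝ) < m := by exact_mod_cast hm
  rcases h𝒞 with rfl | rfl
  · obtain ⟨K, hK⟩ := exists_separatesAt hn hm ha hab Finset.univ
    refine ⟨|K| * m, by positivity, fun r hr μ Y hμ hY => ?_⟩
    -- Changing each mean by at most `r` changes a slack by at most `m * r`; this is the separation
    -- to ask for.
    have hmr : 0 < m * r := by positivity
    have hY' := sat_efConstraints.1 hY.2
    obtain ⟨X', h1, h2, h3⟩ := hK (m * r) hmr μ Y hμ hY.1
      (fun i l => by linarith [hY' i l]) (fun i l h => absurd (Finset.mem_univ _) h)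
    refine ⟨X', h1, fun μ' hμ' => sat_efConstraints.2 fun i l => ?_, h3.trans ?_⟩
    · rcases h2 i l with h | h
      · exact (slack_of_eq h).ge
      · linarith [slack_le_slack_add h1 hμ' i l]
    · rw [← mul_assoc]
      gcongr
      exact le_abs_self K
  · obtain ⟨K, hK⟩ := exists_propSlack_le hn hm ha hab
    refine ⟨|K| * m, by positivity, fun r hr μ Y hμ hY => ?_⟩
    have hmr : 0 < m * r := by positivity
    obtain ⟨X', h1, h2, h3⟩ := hK (m * r) hmr μ Y hμ hY.1 ((sat_propConstraints hY.1).1 hY.2)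
    refine ⟨X', h1, fun μ' hμ' => ?_, h3.trans ?_⟩
    · rcases h2 with rfl | h
      · exact sat_uar hn (Or.inr rfl) μ'
      · exact (sat_propConstraints h1).2 fun i => by
          linarith [propSlack_le_propSlack_add h1 hμ' i, h i]
    · rw [← mul_assoc]
      gcongr
      exact le_abs_self K

/-! ### Concentration of the exploration data. -/

/-- Type, recipient and values of the step at time `t`. -/
def step {Ω : Type*} {n m : ℕ} (typ : ℕ → Ω → Fin m) (rec : ℕ → Ω → Fin n)
    (val : ℕ → Ω → Fin n → ℝ) (t : ℕ) (ω : Ω) : Fin m × Fin n × (Fin n → ℝ) :=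
  (typ t ω, rec t ω, val t ω)

lemma count_history {Ω : Type*} {n m L : ℕ} {typ : ℕ → Ω → Fin m} {rec : ℕ → Ω → Fin n}
    {val : ℕ → Ω → Fin n → ℝ} (i : Fin n) (k : Fin m) (ω : Ω) :
    (count (history typ rec val L ω) i k : ℝ) =
      ∑ s ∈ Finset.range L, if typ s ω = k ∧ rec s ω = i then (1 : ℝ) else 0 := by
  rw [count, Finset.card_filter, Finset.sum_range]
  push_cast
  rfl

section Exploration

variable {n m : ℕ}

/-- The law of one step of the uniform-at-random process: type, recipient and values. -/
noncomputable def uniformStepLaw (ν : Fin n → Fin m → Measure ℝ) :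
    Measure (Fin m × Fin n × (Fin n → ℝ)) :=
  ∑ c : Fin m × Fin n, ENNReal.ofReal (1 / (m : ℝ) * (1 / (n : ℝ))) •
    (Measure.pi fun j => ν j c.1).map fun v => (c.1, c.2, v)

lemma measurable_cell_embedding (κ : Fin m) (i : Fin n) :
    Measurable fun v : Fin n → ℝ => (κ, i, v) := by fun_prop

lemma uniformStepLaw_apply (ν : Fin n → Fin m → Measure ℝ)
    {B : Set (Fin m × Fin n × (Fin n → ℝ))} (hB : MeasurableSet B) :
    uniformStepLaw ν B = ∑ c : Fin m × Fin n, ENNReal.ofReal (1 / (m : ℝ) * (1 / (n : ℝ))) *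
      Measure.pi (fun j => ν j c.1) {v | (c.1, c.2, v) ∈ B} := by
  simp only [uniformStepLaw, Measure.coe_finsetSum, Finset.sum_apply, Measure.smul_apply,
    smul_eq_mul]
  refine Finset.sum_congr rfl fun c _ => ?_
  rw [Measure.map_apply (measurable_cell_embedding _ _) hB]
  rfl

lemma lintegral_uniformStepLaw (ν : Fin n → Fin m → Measure ℝ)
    {G : Fin m × Fin n × (Fin n → ℝ) → ENNReal} (hG : Measurable G) :
    ∫⁻ x, G x ∂(uniformStepLaw ν) =
      ∑ c : Fin m × Fin n, ENNReal.ofReal (1 / (m : ℝ) * (1 / (n : ℝ))) *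
        ∫⁻ v, G (c.1, c.2, v) ∂(Measure.pi fun j => ν j c.1) := by
  simp only [uniformStepLaw, lintegral_finsetSum_measure, lintegral_smul_measure, smul_eq_mul]
  refine Finset.sum_congr rfl fun c _ => ?_
  rw [lintegral_map hG (measurable_cell_embedding _ _)]

variable {Ω : Type*} [MeasurableSpace Ω] {P : Measure Ω}
  {ν : Fin n → Fin m → Measure ℝ} [∀ i k, IsProbabilityMeasure (ν i k)]
  {alg : Policy n m} {T L : ℕ} {typ : ℕ → Ω → Fin m} {rec : ℕ → Ω → Fin n}
  {val : ℕ → Ω → Fin n → ℝ}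

lemma IsOnlineProcess.measurable_step (h : IsOnlineProcess P ν alg T typ rec val) (t : ℕ) :
    Measurable (step typ rec val t) :=
  (h.measurable_typ t).prodMk ((h.measurable_rec t).prodMk (h.measurable_val t))

lemma IsOnlineProcess.measurable_fullPast (h : IsOnlineProcess P ν alg T typ rec val) (t : ℕ) :
    Measurable (fullPast typ rec val t) :=
  measurable_pi_lambda _ fun s => h.measurable_step s

/-- Under UAR the integrand in the process law is constant, so the law of a step factors out of the
past. -/
lemma IsOnlineProcess.measure_fullPast_step (h : IsOnlineProcess P ν alg T typ rec val)
    (hLT : L ≤ T) (hL : ∀ t < L, ∀ H, alg t H = uar n m) {t : ℕ} (ht : t < L)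
    {A : Set (Fin t → Fin m × Fin n × (Fin n → ℝ))} (hA : MeasurableSet A)
    {B : Set (Fin m × Fin n × (Fin n → ℝ))} (hB : MeasurableSet B) :
    P (fullPast typ rec val t ⁻¹' A ∩ step typ rec val t ⁻¹' B) =
      P (fullPast typ rec val t ⁻¹' A) * uniformStepLaw ν B := by
  have hD : ∀ c : Fin m × Fin n, MeasurableSet {v : Fin n → ℝ | (c.1, c.2, v) ∈ B} := fun c =>
    measurable_cell_embedding c.1 c.2 hB
  set E : Fin m × Fin n → Set Ω := fun c => {ω | fullPast typ rec val t ω ∈ A ∧ typ t ω = c.1 ∧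
    rec t ω = c.2 ∧ val t ω ∈ {v : Fin n → ℝ | (c.1, c.2, v) ∈ B}} with hE
  have hEm : ∀ c, MeasurableSet (E c) := fun c =>
    (h.measurable_fullPast t hA).inter
      ((h.measurable_typ t (measurableSet_singleton c.1)).inter
        ((h.measurable_rec t (measurableSet_singleton c.2)).inter (h.measurable_val t (hD c))))
  have hunion : fullPast typ rec val t ⁻¹' A ∩ step typ rec val t ⁻¹' B = ⋃ c, E c := by
    ext ω
    simp only [hE, Set.mem_inter_iff, Set.mem_preimage, step, Set.mem_iUnion, Set.mem_ofPred_eq]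
    constructor
    · rintro ⟨h1, h2⟩
      exact ⟨(typ t ω, rec t ω), h1, rfl, rfl, h2⟩
    · rintro ⟨⟨κ, i⟩, h1, rfl, rfl, h2⟩
      exact ⟨h1, h2⟩
  have hdisj : Pairwise (Function.onFun Disjoint E) := by
    intro c c' hcc
    refine Set.disjoint_left.2 fun ω h1 h2 => hcc ?_
    exact Prod.ext (h1.2.1.symm.trans h2.2.1) (h1.2.2.1.symm.trans h2.2.2.1)
  rw [hunion, measure_iUnion hdisj hEm, tsum_fintype, uniformStepLaw_apply ν hB, Finset.mul_sum]
  refine Finset.sum_congr rfl fun c _ => ?_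
  rw [hE, h.law t (ht.trans_le hLT) A hA c.1 c.2 _ (hD c)]
  simp only [hL t ht, uar, lintegral_const, Measure.restrict_apply_univ]
  rw [mul_comm (ENNReal.ofReal _), mul_assoc]
  rfl

variable [IsProbabilityMeasure P]

lemma IsOnlineProcess.map_step (h : IsOnlineProcess P ν alg T typ rec val)
    (hLT : L ≤ T) (hL : ∀ t < L, ∀ H, alg t H = uar n m) {t : ℕ} (ht : t < L) :
    P.map (step typ rec val t) = uniformStepLaw ν := by
  ext B hB
  have := h.measure_fullPast_step hLT hL ht MeasurableSet.univ hB
  simpa [Measure.map_apply (h.measurable_step t) hB] using this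

lemma IsOnlineProcess.indepFun_step (h : IsOnlineProcess P ν alg T typ rec val)
    (hLT : L ≤ T) (hL : ∀ t < L, ∀ H, alg t H = uar n m) {t : ℕ} (ht : t < L) :
    IndepFun (fullPast typ rec val t) (step typ rec val t) P := by
  rw [indepFun_iff_measure_inter_preimage_eq_mul]
  intro A B hA hB
  rw [h.measure_fullPast_step hLT hL ht hA hB, ← h.map_step hLT hL ht,
    Measure.map_apply (h.measurable_step t) hB]

/-- Independence of each step from its past suffices to peel off one factor at a time. -/
lemma IsOnlineProcess.lintegral_prod_step (h : IsOnlineProcess P ν alg T typ rec val)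
    (hLT : L ≤ T) (hL : ∀ t < L, ∀ H, alg t H = uar n m)
    {G : Fin m × Fin n × (Fin n → ℝ) → ENNReal} (hG : Measurable G) {t : ℕ} (ht : t ≤ L) :
    ∫⁻ ω, ∏ s ∈ Finset.range t, G (step typ rec val s ω) ∂P =
      (∫⁻ x, G x ∂(uniformStepLaw ν)) ^ t := by
  induction t with
  | zero => simp
  | succ t ih =>
    have hF : Measurable fun H : Fin t → Fin m × Fin n × (Fin n → ℝ) => ∏ s, G (H s) := by
      fun_prop
    have hpast : ∀ ω, ∏ s ∈ Finset.range t, G (step typ rec val s ω) =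
        ∏ s, G (fullPast typ rec val t ω s) := fun ω => by
      rw [Finset.prod_range]
      rfl
    have hind := (h.indepFun_step hLT hL ht).comp hF hG
    have h1 := lintegral_mul_eq_lintegral_mul_lintegral_of_indepFun
      (hF.comp (h.measurable_fullPast t)) (hG.comp (h.measurable_step t)) hind
    rw [pow_succ, ← ih (Nat.le_of_succ_le ht), ← h.map_step hLT hL ht,
      lintegral_map hG (h.measurable_step t)]
    simp_rw [Finset.prod_range_succ, hpast]
    exact h1

/-- Chernoff's bound for sums over the exploration steps. -/
lemma IsOnlineProcess.measure_sum_ge_le (h : IsOnlineProcess P ν alg T typ rec val)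
    (hLT : L ≤ T) (hL : ∀ t < L, ∀ H, alg t H = uar n m)
    {Z : Fin m × Fin n × (Fin n → ℝ) → ℝ} (hZ : Measurable Z) {c : ℝ}
    (hc : ∫⁻ x, ENNReal.ofReal (Real.exp (Z x)) ∂(uniformStepLaw ν) ≤
      ENNReal.ofReal (Real.exp c)) (x : ℝ) :
    P {ω | x ≤ ∑ s ∈ Finset.range L, Z (step typ rec val s ω)} ≤
      ENNReal.ofReal (Real.exp (L * c - x)) := by
  have hG : Measurable fun y => ENNReal.ofReal (Real.exp (Z y)) := by fun_prop
  have h1 := h.lintegral_prod_step hLT hL hG le_rfl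
  have h2 : ∀ ω, ∏ s ∈ Finset.range L, ENNReal.ofReal (Real.exp (Z (step typ rec val s ω))) =
      ENNReal.ofReal (Real.exp (∑ s ∈ Finset.range L, Z (step typ rec val s ω))) := fun ω => by
    rw [Real.exp_sum, ENNReal.ofReal_prod_of_nonneg fun _ _ => (Real.exp_pos _).le]
  simp_rw [h2] at h1
  have hmeas : Measurable fun ω =>
      ENNReal.ofReal (Real.exp (∑ s ∈ Finset.range L, Z (step typ rec val s ω))) := by
    have : ∀ s, Measurable fun ω => Z (step typ rec val s ω) := fun s =>
      hZ.comp (h.measurable_step s)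
    exact ENNReal.measurable_ofReal.comp
      (Real.measurable_exp.comp (Finset.measurable_fun_sum _ fun s _ => this s))
  have h3 := mul_meas_ge_le_lintegral (μ := P) hmeas (ENNReal.ofReal (Real.exp x))
  have hset : {ω | x ≤ ∑ s ∈ Finset.range L, Z (step typ rec val s ω)} ⊆
      {ω | ENNReal.ofReal (Real.exp x) ≤
        ENNReal.ofReal (Real.exp (∑ s ∈ Finset.range L, Z (step typ rec val s ω)))} :=
    fun ω hω => ENNReal.ofReal_le_ofReal (Real.exp_le_exp.2 hω)
  have h4 : ENNReal.ofReal (Real.exp x) *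
      P {ω | x ≤ ∑ s ∈ Finset.range L, Z (step typ rec val s ω)} ≤
      ENNReal.ofReal (Real.exp (L * c)) := by
    calc _ ≤ _ := mul_le_mul_right (measure_mono hset) _
      _ ≤ _ := h3
      _ = _ := h1
      _ ≤ ENNReal.ofReal (Real.exp c) ^ L := pow_le_pow_left' hc L
      _ = _ := by rw [← ENNReal.ofReal_pow (Real.exp_pos _).le, ← Real.exp_nat_mul]
  have h5 : ENNReal.ofReal (Real.exp (L * c - x)) =
      ENNReal.ofReal (Real.exp (-x)) * ENNReal.ofReal (Real.exp (L * c)) := by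
    rw [← ENNReal.ofReal_mul (Real.exp_pos _).le, ← Real.exp_add]
    congr 2
    ring
  have h6 : ENNReal.ofReal (Real.exp (-x)) * ENNReal.ofReal (Real.exp x) = 1 := by
    rw [← ENNReal.ofReal_mul (Real.exp_pos _).le, ← Real.exp_add]
    simp
  calc P {ω | x ≤ ∑ s ∈ Finset.range L, Z (step typ rec val s ω)}
      = ENNReal.ofReal (Real.exp (-x)) * (ENNReal.ofReal (Real.exp x) *
        P {ω | x ≤ ∑ s ∈ Finset.range L, Z (step typ rec val s ω)}) := by
          rw [← mul_assoc, h6, one_mul]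
    _ ≤ _ := by
      rw [h5]
      exact mul_le_mul_right h4 _

lemma sum_const_uniform (hn : 0 < n) (hm : 0 < m) :
    ∑ _c : Fin m × Fin n, 1 / (m : ℝ) * (1 / (n : ℝ)) = 1 := by
  have : (n : ℝ) ≠ 0 := by positivity
  have : (m : ℝ) ≠ 0 := by positivity
  simp
  field_simp

lemma sum_const_uniform_ennreal (hn : 0 < n) (hm : 0 < m) :
    ∑ _c : Fin m × Fin n, ENNReal.ofReal (1 / (m : ℝ) * (1 / (n : ℝ))) = 1 := by
  rw [← ENNReal.ofReal_sum_of_nonneg fun _ _ => by positivity, sum_const_uniform hn hm,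
    ENNReal.ofReal_one]

lemma exp_neg_one_le_half : Real.exp (-1) ≤ 1 / 2 := by
  rw [Real.exp_neg, ← one_div]
  exact one_div_le_one_div_of_le two_pos (by linarith [Real.add_one_le_exp (1 : ℝ)])

/-- The cell `(i, k)` is sampled at least a quarter as often as expected. -/
lemma IsOnlineProcess.measure_count_le (h : IsOnlineProcess P ν alg T typ rec val)
    (hLT : L ≤ T) (hL : ∀ t < L, ∀ H, alg t H = uar n m) (hn : 0 < n) (hm : 0 < m)
    (i : Fin n) (k : Fin m) :
    P {ω | (count (history typ rec val L ω) i k : ℝ) ≤ L / (4 * (n * m))} ≤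
      ENNReal.ofReal (Real.exp (-(L / (4 * (n * m))))) := by
  have hn' : (0 : ℝ) < n := by exact_mod_cast hn
  have hm' : (0 : ℝ) < m := by exact_mod_cast hm
  set Z : Fin m × Fin n × (Fin n → ℝ) → ℝ := fun y =>
    -(if y.1 = k ∧ y.2.1 = i then (1 : ℝ) else 0) with hZdef
  have hZ : Measurable Z := by
    refine Measurable.neg (Measurable.ite ?_ measurable_const measurable_const)
    exact (measurable_fst (measurableSet_singleton k)).inter
      ((measurable_fst.comp measurable_snd) (measurableSet_singleton i))
  -- Since `exp (-1) ≤ 1 / 2`, the expectation is at most `1 - 1 / (2 * n * m)`. Half of the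
  -- resulting exponent is spent on the threshold `L / (4 * n * m)`.
  have hc : ∫⁻ x, ENNReal.ofReal (Real.exp (Z x)) ∂(uniformStepLaw ν) ≤
      ENNReal.ofReal (Real.exp (-(1 / (2 * (n * m))))) := by
    rw [lintegral_uniformStepLaw ν (by fun_prop)]
    have h1 : ∀ c : Fin m × Fin n, ENNReal.ofReal (1 / (m : ℝ) * (1 / (n : ℝ))) *
        ∫⁻ v, ENNReal.ofReal (Real.exp (Z (c.1, c.2, v))) ∂(Measure.pi fun j => ν j c.1) ≤
        ENNReal.ofReal (1 / (m : ℝ) * (1 / (n : ℝ)) * (1 - if c = (k, i) then 1 / 2 else 0)) := by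
      intro c
      rw [ENNReal.ofReal_mul (p := 1 / (m : ℝ) * (1 / (n : ℝ))) (by positivity)]
      gcongr
      change ∫⁻ _, ENNReal.ofReal (Real.exp (-(if c.1 = k ∧ c.2 = i then (1 : ℝ) else 0))) ∂_ ≤ _
      rw [lintegral_const, measure_univ, mul_one]
      refine ENNReal.ofReal_le_ofReal ?_
      by_cases hc : c = (k, i)
      · subst hc
        have := exp_neg_one_le_half
        norm_num at this ⊢
        linarith
      · have : ¬ (c.1 = k ∧ c.2 = i) := fun hcc => hc (Prod.ext hcc.1 hcc.2)
        simp [hc, this]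
    refine (Finset.sum_le_sum fun c _ => h1 c).trans ?_
    rw [← ENNReal.ofReal_sum_of_nonneg fun c _ => by
      have : (0 : ℝ) ≤ 1 - if c = (k, i) then 1 / 2 else 0 := by split_ifs <;> norm_num
      positivity]
    refine ENNReal.ofReal_le_ofReal ?_
    simp_rw [mul_sub, mul_one]
    rw [Finset.sum_sub_distrib, sum_const_uniform hn hm, ← Finset.mul_sum]
    have h2 := Real.add_one_le_exp (-(1 / (2 * ((n : ℝ) * m))))
    have h3 : 1 / (m : ℝ) * (1 / (n : ℝ)) * (1 / 2) = 1 / (2 * ((n : ℝ) * m)) := by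
      field_simp
    rw [Finset.sum_ite_eq' Finset.univ (k, i), if_pos (Finset.mem_univ _), h3]
    linarith
  refine (measure_mono fun ω hω => ?_).trans
    ((h.measure_sum_ge_le hLT hL hZ hc (-(L / (4 * (n * m))))).trans_eq ?_)
  · simp only [Set.mem_ofPred_eq, count_history] at hω ⊢
    simp only [hZdef, step, Finset.sum_neg_distrib]
    linarith
  · congr 2
    field_simp
    ring

lemma lintegral_exp_subgaussian_le {ρ : Measure ℝ} [IsProbabilityMeasure ρ] {μ : ℝ} {σ : ℝ≥0}
    (hσ : HasSubgaussianMGF (fun x => x - μ) (σ ^ 2) ρ) {V : ℝ} (hV : (σ : ℝ) ^ 2 ≤ V) (l : ℝ) :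
    ∫⁻ x, ENNReal.ofReal (Real.exp (l * (x - μ) - l ^ 2 * V / 2)) ∂ρ ≤ 1 := by
  have h1 : ∀ x, ENNReal.ofReal (Real.exp (l * (x - μ) - l ^ 2 * V / 2)) =
      ENNReal.ofReal (Real.exp (-(l ^ 2 * V / 2))) *
        ENNReal.ofReal (Real.exp (l * (x - μ))) := fun x => by
    rw [← ENNReal.ofReal_mul (Real.exp_pos _).le, ← Real.exp_add]
    congr 2
    ring
  simp_rw [h1]
  rw [lintegral_const_mul _ (by fun_prop), ← ofReal_integral_eq_lintegral_ofReal
    (hσ.integrable_exp_mul l) (ae_of_all _ fun _ => (Real.exp_pos _).le),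
    ← ENNReal.ofReal_mul (Real.exp_pos _).le]
  refine ENNReal.ofReal_le_one.2 ?_
  have h2 : ∫ x, Real.exp (l * (x - μ)) ∂ρ ≤ Real.exp (l ^ 2 * V / 2) := by
    refine (hσ.mgf_le l).trans (Real.exp_le_exp.2 ?_)
    push_cast
    nlinarith [sq_nonneg l]
  calc _ ≤ Real.exp (-(l ^ 2 * V / 2)) * Real.exp (l ^ 2 * V / 2) := by gcongr
    _ = 1 := by rw [← Real.exp_add]; simp

/-- The deviation of the samples of the cell `(i, k)`, for a fixed exponential tilt. -/
lemma IsOnlineProcess.measure_deviation_le (h : IsOnlineProcess P ν alg T typ rec val)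
    (hLT : L ≤ T) (hL : ∀ t < L, ∀ H, alg t H = uar n m) (hn : 0 < n) (hm : 0 < m)
    {σ : ℝ≥0} (hν : IsSubGaussian ν σ) {V : ℝ} (hV : (σ : ℝ) ^ 2 ≤ V)
    (i : Fin n) (k : Fin m) (l x : ℝ) :
    P {ω | x ≤ ∑ s ∈ Finset.range L, if typ s ω = k ∧ rec s ω = i then
      l * (val s ω i - meanMatrix ν i k) - l ^ 2 * V / 2 else 0} ≤
      ENNReal.ofReal (Real.exp (-x)) := by
  set Z : Fin m × Fin n × (Fin n → ℝ) → ℝ := fun y =>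
    if y.1 = k ∧ y.2.1 = i then l * (y.2.2 i - meanMatrix ν i k) - l ^ 2 * V / 2 else 0 with hZdef
  have hZ : Measurable Z := by
    refine Measurable.ite ?_ (by fun_prop) measurable_const
    exact (measurable_fst (measurableSet_singleton k)).inter
      ((measurable_fst.comp measurable_snd) (measurableSet_singleton i))
  have hc : ∫⁻ x, ENNReal.ofReal (Real.exp (Z x)) ∂(uniformStepLaw ν) ≤
      ENNReal.ofReal (Real.exp 0) := by
    rw [lintegral_uniformStepLaw ν (by fun_prop), Real.exp_zero, ENNReal.ofReal_one,
      ← sum_const_uniform_ennreal hn hm]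
    refine Finset.sum_le_sum fun c _ => mul_le_of_le_one_right' ?_
    by_cases hc : c.1 = k ∧ c.2 = i
    · simp only [hZdef, hc, and_self, if_true]
      have h1 := (measurePreserving_eval (fun j => ν j k) i).lintegral_comp
        (f := fun y => ENNReal.ofReal (Real.exp (l * (y - meanMatrix ν i k) - l ^ 2 * V / 2)))
        (by fun_prop)
      exact h1.trans_le (lintegral_exp_subgaussian_le (hν i k) hV l)
    · simp [hZdef, hc]
  refine (h.measure_sum_ge_le hLT hL hZ hc x).trans_eq ?_
  simp

/-- The sample count is random, so a union bound runs over its possible values `N`, each with its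
own fixed tilt. The exponential weights of `measure_deviation_le` have mean at most one per step
whether or not the cell is hit, so no conditioning on the count is needed. -/
lemma IsOnlineProcess.measure_cell_le (h : IsOnlineProcess P ν alg T typ rec val)
    (hLT : L ≤ T) (hL : ∀ t < L, ∀ H, alg t H = uar n m) (hn : 0 < n) (hm : 0 < m)
    {σ : ℝ≥0} (hν : IsSubGaussian ν σ) {V : ℝ} (hV0 : 0 < V) (hV : (σ : ℝ) ^ 2 ≤ V)
    (i : Fin n) (k : Fin m) :
    P {ω | ¬ (L / (4 * (n * m)) < (count (history typ rec val L ω) i k : ℝ) ∧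
      |muHat (history typ rec val L ω) i k - meanMatrix ν i k| ≤
        radius T (history typ rec val L ω) i k)} ≤
      ENNReal.ofReal (Real.exp (-(L / (4 * (n * m)))) +
        2 * L * Real.exp (-(Real.log (4 * T * n * m) ^ 2 / (4 * V)))) := by
  set ℓ := Real.log (4 * T * n * m) with hℓ
  set r : ℕ → ℝ := fun N => Real.sqrt (ℓ ^ 2 / (2 * (N : ℝ))) with hr
  set E : ℝ → Set Ω := fun l => {ω | ℓ ^ 2 / (4 * V) ≤ ∑ s ∈ Finset.range L,
    if typ s ω = k ∧ rec s ω = i then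
      l * (val s ω i - meanMatrix ν i k) - l ^ 2 * V / 2 else 0} with hE
  have hEle : ∀ l, P (E l) ≤ ENNReal.ofReal (Real.exp (-(ℓ ^ 2 / (4 * V)))) := fun l =>
    h.measure_deviation_le hLT hL hn hm hν hV i k l _
  have hsub : {ω | ¬ (L / (4 * (n * m)) < (count (history typ rec val L ω) i k : ℝ) ∧
      |muHat (history typ rec val L ω) i k - meanMatrix ν i k| ≤
        radius T (history typ rec val L ω) i k)} ⊆
      {ω | (count (history typ rec val L ω) i k : ℝ) ≤ L / (4 * (n * m))} ∪
        ⋃ N ∈ Finset.Icc 1 L, (E (r N / V) ∪ E (-(r N / V))) := by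
    intro ω hω
    by_cases hc : (count (history typ rec val L ω) i k : ℝ) ≤ L / (4 * (n * m))
    · exact Or.inl hc
    right
    push Not at hc
    have hdev : radius T (history typ rec val L ω) i k <
        |muHat (history typ rec val L ω) i k - meanMatrix ν i k| := by
      by_contra hcon
      exact hω ⟨hc, not_lt.1 hcon⟩
    set N := count (history typ rec val L ω) i k with hN
    have hN0 : (0 : ℝ) < N := lt_of_le_of_lt (by positivity) hc
    have hN1 : 1 ≤ N := by exact_mod_cast hN0
    have hNL : N ≤ L := by
      refine (Finset.card_le_univ _).trans_eq ?_
      simp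
    refine Set.mem_biUnion (x := N) (Finset.mem_coe.2 (Finset.mem_Icc.2 ⟨hN1, hNL⟩)) ?_
    have hrad : radius T (history typ rec val L ω) i k = r N := rfl
    have hr2 : N * r N ^ 2 = ℓ ^ 2 / 2 := by
      rw [hr]
      dsimp only
      rw [Real.sq_sqrt (by positivity)]
      field_simp
    have hr0 : 0 ≤ r N := Real.sqrt_nonneg _
    set D := N * (muHat (history typ rec val L ω) i k - meanMatrix ν i k) with hD
    have hmu : N * muHat (history typ rec val L ω) i k =
        ∑ s ∈ Finset.range L, if typ s ω = k ∧ rec s ω = i then val s ω i else 0 := by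
      rw [muHat, mul_div_cancel₀ _ hN0.ne', Finset.sum_range]
      refine Finset.sum_congr rfl fun s _ => ?_
      by_cases hs : typ s ω = k ∧ rec s ω = i
      · simp only [history, hs, and_self, if_true]
      · simp only [history, hs, if_false]
    have hsum : ∀ l : ℝ, (∑ s ∈ Finset.range L, if typ s ω = k ∧ rec s ω = i then
        l * (val s ω i - meanMatrix ν i k) - l ^ 2 * V / 2 else 0) =
        l * D - N * (l ^ 2 * V / 2) := by
      intro l
      rw [hD, mul_sub, hmu, hN, count_history, Finset.sum_mul, Finset.sum_mul,
        ← Finset.sum_sub_distrib, Finset.mul_sum, ← Finset.sum_sub_distrib]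
      refine Finset.sum_congr rfl fun s _ => ?_
      split_ifs <;> ring
    -- The tilt `r N / V` maximises `l * (N * r N) - N * l ^ 2 * V / 2`, with value `N * (r N) ^ 2 /
    -- (2 * V)`.
    have hkey : ∀ x : ℝ, N * r N ≤ x → ℓ ^ 2 / (4 * V) ≤
        r N / V * x - N * ((r N / V) ^ 2 * V / 2) := by
      intro x hx
      have h1 : r N / V * (N * r N) ≤ r N / V * x := by gcongr
      have h2 : r N / V * (N * r N) - N * ((r N / V) ^ 2 * V / 2) = N * r N ^ 2 / (2 * V) := by
        field_simp
        ring
      rw [hr2] at h2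
      have h3 : ℓ ^ 2 / 2 / (2 * V) = ℓ ^ 2 / (4 * V) := by
        field_simp
        norm_num
      linarith
    rw [hrad] at hdev
    rcases lt_abs.1 hdev with hp | hp
    · left
      have h1 := hkey D (mul_le_mul_of_nonneg_left hp.le hN0.le)
      change ℓ ^ 2 / (4 * V) ≤ _
      rwa [hsum]
    · right
      have h1 := hkey (-D) (by
        rw [hD, ← mul_neg]
        exact mul_le_mul_of_nonneg_left hp.le hN0.le)
      change ℓ ^ 2 / (4 * V) ≤ _
      rw [hsum]
      linarith
  have h1 := h.measure_count_le hLT hL hn hm i k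
  have h2 : P (⋃ N ∈ Finset.Icc 1 L, (E (r N / V) ∪ E (-(r N / V)))) ≤
      ENNReal.ofReal (2 * L * Real.exp (-(ℓ ^ 2 / (4 * V)))) := by
    refine (measure_biUnion_finset_le _ _).trans ?_
    calc ∑ N ∈ Finset.Icc 1 L, P (E (r N / V) ∪ E (-(r N / V)))
        ≤ ∑ _N ∈ Finset.Icc 1 L, ENNReal.ofReal (2 * Real.exp (-(ℓ ^ 2 / (4 * V)))) := by
          refine Finset.sum_le_sum fun N _ => (measure_union_le _ _).trans ?_
          rw [two_mul, ENNReal.ofReal_add (Real.exp_pos _).le (Real.exp_pos _).le]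
          exact add_le_add (hEle _) (hEle _)
      _ = _ := by
          rw [← ENNReal.ofReal_sum_of_nonneg fun _ _ => by positivity]
          simp
          ring_nf
  rw [ENNReal.ofReal_add (Real.exp_pos _).le (by positivity)]
  exact (measure_mono hsub).trans ((measure_union_le _ _).trans (add_le_add h1 h2))

/-- The exploration data satisfy the confidence bounds and every cell is sampled often. -/
def GoodData (T : ℕ) (μ : Mat n m) (H : History n m L) : Prop :=
  ∀ i k, L / (4 * (n * m)) < (count H i k : ℝ) ∧ |muHat H i k - μ i k| ≤ radius T H i k

theorem IsOnlineProcess.measure_not_goodData_le (h : IsOnlineProcess P ν alg T typ rec val)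
    (hLT : L ≤ T) (hL : ∀ t < L, ∀ H, alg t H = uar n m) (hn : 0 < n) (hm : 0 < m)
    {σ : ℝ≥0} (hν : IsSubGaussian ν σ) {V : ℝ} (hV0 : 0 < V) (hV : (σ : ℝ) ^ 2 ≤ V) :
    P {ω | ¬ GoodData T (meanMatrix ν) (history typ rec val L ω)} ≤
      ENNReal.ofReal (n * m * (Real.exp (-(L / (4 * (n * m)))) +
        2 * L * Real.exp (-(Real.log (4 * T * n * m) ^ 2 / (4 * V))))) := by
  have hsub : {ω | ¬ GoodData T (meanMatrix ν) (history typ rec val L ω)} ⊆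
      ⋃ c : Fin n × Fin m, {ω | ¬ (L / (4 * (n * m)) <
        (count (history typ rec val L ω) c.1 c.2 : ℝ) ∧
        |muHat (history typ rec val L ω) c.1 c.2 - meanMatrix ν c.1 c.2| ≤
        radius T (history typ rec val L ω) c.1 c.2)} := by
    intro ω hω
    by_contra hcon
    refine hω fun i k => ?_
    by_contra hik
    exact hcon (Set.mem_iUnion.2 ⟨(i, k), hik⟩)
  refine (measure_mono hsub).trans ((measure_iUnion_le _).trans ?_)
  rw [tsum_fintype]
  refine (Finset.sum_le_sum fun c _ =>
    h.measure_cell_le hLT hL hn hm hν hV0 hV c.1 c.2).trans_eq ?_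
  rw [← ENNReal.ofReal_sum_of_nonneg fun _ _ => by positivity]
  simp [mul_add]

end Exploration

/-! ### From good data to fairness and regret. -/

section Regret

variable {n m : ℕ}

lemma exploreLen_le {T : ℕ} (hT : 1 ≤ T) : exploreLen T ≤ T := by
  have hT' : (1 : ℝ) ≤ T := by exact_mod_cast hT
  refine Nat.ceil_le.2 ?_
  calc (T : ℝ) ^ (2 / 3 : ℝ) ≤ (T : ℝ) ^ (1 : ℝ) :=
        Real.rpow_le_rpow_of_exponent_le hT' (by norm_num)
    _ = T := Real.rpow_one _

lemma rpow_two_thirds {x : ℝ} (hx : 0 ≤ x) : x ^ (2 / 3 : ℝ) = (x ^ (1 / 3 : ℝ)) ^ 2 := by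
  rw [← Real.rpow_natCast, ← Real.rpow_mul hx]
  norm_num

lemma cube_rpow_one_third {x : ℝ} (hx : 0 ≤ x) : (x ^ (1 / 3 : ℝ)) ^ 3 = x := by
  rw [← Real.rpow_natCast, ← Real.rpow_mul hx]
  norm_num

/-- On good data, the solution of the robust program is fair and almost optimal. -/
lemma GoodData.sat_and_frob_sub_le {L T : ℕ} {μ : Mat n m} {H : History n m L} {ρ K : ℝ}
    (hH : GoodData T μ H) (hρ : ∀ i k, radius T H i k ≤ ρ)
    {𝒞 : ConstraintFamily n m} {X X' Y : Mat n m}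
    (hX : IsLPSolution (robustFairSet 𝒞 (confidenceBox T H)) (muHat H) X)
    (hX' : IsAllocation X')
    (hrob : ∀ μ' : Mat n m, (∀ i k, |μ' i k - μ i k| ≤ 2 * ρ) → 𝒞.Sat μ' X')
    (hK : frob Y μ - frob X' μ ≤ K) :
    𝒞.Sat μ X ∧ frob Y μ - frob X μ ≤ K + 2 * m * ρ := by
  have hdist : ∀ i k, |muHat H i k - μ i k| ≤ ρ := fun i k => (hH i k).2.trans (hρ i k)
  refine ⟨hX.1.2 μ fun i k _ => ?_, ?_⟩
  · have := abs_le.1 (hH i k).2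
    exact ⟨by linarith, by linarith⟩
  -- The box is centred at `muHat`, not at `μ`; the triangle inequality puts it within `2 * ρ` of
  -- `μ`.
  · have hmem : X' ∈ robustFairSet 𝒞 (confidenceBox T H) := by
      refine ⟨hX', fun μ' hμ' => hrob μ' fun i k => ?_⟩
      have hpos : 0 < count H i k := by
        have : (0 : ℝ) < count H i k := lt_of_le_of_lt (by positivity) (hH i k).1
        exact_mod_cast this
      have h1 := hμ' i k hpos
      have h2 := abs_le.1 (hdist i k)
      have h3 := hρ i k
      exact abs_le.2 ⟨by linarith, by linarith⟩
    have h1 := hX.2 X' hmem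
    have h2 := hX.1.1.frob_le (A := fun i k => muHat H i k - μ i k) (b := ρ)
      fun i k => (abs_le.1 (hdist i k)).2
    have h3 := hX'.frob_le (A := fun i k => μ i k - muHat H i k) (b := ρ)
      fun i k => by linarith [(abs_le.1 (hdist i k)).1]
    rw [frob_sub_right] at h2 h3
    linarith

lemma GoodData.radius_le {T : ℕ} (hT : 1 ≤ T) (hn : 0 < n) (hm : 0 < m) {μ : Mat n m}
    {H : History n m (exploreLen T)} (hH : GoodData T μ H) (i : Fin n) (k : Fin m) :
    radius T H i k ≤ Real.log (4 * T * n * m) * (2 * (n * m)) / (T : ℝ) ^ (1 / 3 : ℝ) := by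
  have hT' : (1 : ℝ) ≤ T := by exact_mod_cast hT
  have hn' : (1 : ℝ) ≤ n := by exact_mod_cast hn
  have hm' : (1 : ℝ) ≤ m := by exact_mod_cast hm
  have hnm : 1 ≤ (n : ℝ) * m := one_le_mul_of_one_le_of_one_le hn' hm'
  set u := (T : ℝ) ^ (1 / 3 : ℝ) with hu
  have hu0 : 0 < u := by positivity
  have hlog : 0 ≤ Real.log (4 * T * n * m) := Real.log_nonneg (by
    have : 1 ≤ (T : ℝ) * (n * m) := one_le_mul_of_one_le_of_one_le hT' hnm
    linarith)
  refine Real.sqrt_le_iff.2 ⟨by positivity, ?_⟩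
  have hL : u ^ 2 ≤ exploreLen T := by
    rw [hu, ← rpow_two_thirds (by positivity)]
    exact Nat.le_ceil _
  have hc : u ^ 2 / (4 * (n * m)) ≤ count H i k :=
    le_trans (by gcongr) (hH i k).1.le
  have hc0 : 0 < u ^ 2 / (4 * ((n : ℝ) * m)) := by positivity
  calc Real.log (4 * T * n * m) ^ 2 / (2 * (count H i k : ℝ))
      ≤ Real.log (4 * T * n * m) ^ 2 / (2 * (u ^ 2 / (4 * (n * m)))) := by gcongr
    _ = Real.log (4 * T * n * m) ^ 2 * (2 * (n * m)) / u ^ 2 := by field_simp; ring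
    _ ≤ Real.log (4 * T * n * m) ^ 2 * (2 * (n * m)) ^ 2 / u ^ 2 := by
        gcongr
        nlinarith
    _ = _ := by ring

lemma fairETC_of_lt {T : ℕ} (Xhat : History n m (exploreLen T) → Mat n m) {t : ℕ}
    (ht : t < exploreLen T) (H : History n m t) : fairETC T Xhat t H = uar n m := by
  simp [fairETC, ht]

lemma fairETC_history_of_le {Ω : Type*} {T : ℕ} (Xhat : History n m (exploreLen T) → Mat n m)
    {typ : ℕ → Ω → Fin m} {rec : ℕ → Ω → Fin n} {val : ℕ → Ω → Fin n → ℝ} {t : ℕ}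
    (ht : exploreLen T ≤ t) (ω : Ω) :
    fairETC T Xhat t (history typ rec val t ω) =
      Xhat (history typ rec val (exploreLen T) ω) := by
  simp only [fairETC, not_lt.2 ht, dif_neg, not_false_eq_true]
  rfl

/-- The regret is that of the exploration steps plus that of the commitment. -/
lemma regret_fairETC_le {Ω : Type*} {T : ℕ} (hT : 1 ≤ T) (hn : 0 < n)
    (Xhat : History n m (exploreLen T) → Mat n m)
    {typ : ℕ → Ω → Fin m} {rec : ℕ → Ω → Fin n} {val : ℕ → Ω → Fin n → ℝ} {ω : Ω}
    {μ Y : Mat n m} {b c : ℝ} (hμ : ∀ i k, 0 ≤ μ i k ∧ μ i k ≤ b) (hY : IsAllocation Y)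
    (hb : 0 ≤ b) (hc0 : 0 ≤ c)
    (hc : frob Y μ - frob (Xhat (history typ rec val (exploreLen T) ω)) μ ≤ c) :
    regret (fairETC T Xhat) μ Y T typ rec val ω ≤ 2 * (m * b) * (T : ℝ) ^ (2 / 3 : ℝ) + T * c := by
  have hT' : (1 : ℝ) ≤ T := by exact_mod_cast hT
  have h1 : regret (fairETC T Xhat) μ Y T typ rec val ω =
      ∑ t ∈ Finset.range T, (frob Y μ - frob (fairETC T Xhat t (history typ rec val t ω)) μ) := by
    simp [regret]
  have h2 : ∀ t ∈ Finset.range T,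
      frob Y μ - frob (fairETC T Xhat t (history typ rec val t ω)) μ ≤
        (if t < exploreLen T then m * b else 0) + c := by
    intro t _
    by_cases ht : t < exploreLen T
    · rw [fairETC_of_lt _ ht, if_pos ht]
      have h3 := hY.frob_le fun i k => (hμ i k).2
      have h4 := (isAllocation_uar (m := m) hn).frob_nonneg fun i k => (hμ i k).1
      linarith
    · rw [fairETC_history_of_le _ (not_lt.1 ht), if_neg ht, zero_add]
      exact hc
  have h3 : (exploreLen T : ℝ) ≤ 2 * (T : ℝ) ^ (2 / 3 : ℝ) := by
    have h4 : (1 : ℝ) ≤ (T : ℝ) ^ (2 / 3 : ℝ) := Real.one_le_rpow hT' (by norm_num)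
    have h5 := Nat.ceil_lt_add_one (zero_le_one.trans h4)
    unfold exploreLen
    linarith
  have h4 : ∑ t ∈ Finset.range T, (if t < exploreLen T then (m : ℝ) * b else 0) =
      exploreLen T * (m * b) := by
    rw [← Finset.sum_filter]
    have : (Finset.range T).filter (fun t => t < exploreLen T) =
        Finset.range (exploreLen T) := by
      have := exploreLen_le hT
      ext t
      simp
      omega
    rw [this]
    simp
  calc _ = _ := h1
    _ ≤ _ := Finset.sum_le_sum h2
    _ = exploreLen T * (m * b) + T * c := by
      rw [Finset.sum_add_distrib, h4]
      simp
    _ ≤ 2 * (T : ℝ) ^ (2 / 3 : ℝ) * (m * b) + T * c := by gcongr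
    _ = _ := by ring

/-- The failure probability of the confidence bounds is at most `1 / T` for large `T`. -/
lemma exists_failure_prob_le (hn : 0 < n) (hm : 0 < m) {V : ℝ} (hV : 0 < V) :
    ∃ T₀ : ℕ, 3 ≤ T₀ ∧ ∀ T : ℕ, T₀ ≤ T →
      n * m * (Real.exp (-(exploreLen T / (4 * (n * m)))) +
        2 * exploreLen T * Real.exp (-(Real.log (4 * T * n * m) ^ 2 / (4 * V)))) ≤
      1 / (T : ℝ) := by
  -- The cube makes `T ^ (1 / 3) ≥ 64 * (n * m) ^ 3`, which controls undersampling through the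
  -- quadratic bound on `exp`. The last term makes `ℓ ≥ 12 * V`, so that the squared logarithm in
  -- the radius gives `ℓ ^ 2 / (4 * V) ≥ 3 * ℓ` although the radius does not involve the variance
  -- proxy. The `3` is for `log T ≥ 1`, used later.
  refine ⟨3 + (64 * (n * m) ^ 3) ^ 3 + ⌈Real.exp (12 * V)⌉₊, by omega, fun T hT => ?_⟩
  have hT3 : 1 ≤ T := by omega
  have hTu : (64 * (n * m) ^ 3) ^ 3 ≤ T := by omega
  have hTV : Real.exp (12 * V) ≤ T := by
    refine (Nat.le_ceil _).trans ?_
    exact_mod_cast (by omega : ⌈Real.exp (12 * V)⌉₊ ≤ T)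
  have hT' : (1 : ℝ) ≤ T := by exact_mod_cast hT3
  have hn' : (1 : ℝ) ≤ n := by exact_mod_cast hn
  have hm' : (1 : ℝ) ≤ m := by exact_mod_cast hm
  set N : ℝ := n * m with hN
  have hN1 : 1 ≤ N := one_le_mul_of_one_le_of_one_le hn' hm'
  set u := (T : ℝ) ^ (1 / 3 : ℝ) with hu
  have hu0 : 0 < u := by positivity
  have hu3 : u ^ 3 = T := cube_rpow_one_third (by positivity)
  have huN : 64 * N ^ 3 ≤ u := by
    refine le_of_pow_le_pow_left₀ (n := 3) (by norm_num) hu0.le ?_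
    rw [hu3, hN]
    exact_mod_cast hTu
  have hL : u ^ 2 ≤ exploreLen T := by
    rw [hu, ← rpow_two_thirds (by positivity)]
    exact Nat.le_ceil _
  have hLT : (exploreLen T : ℝ) ≤ T := by exact_mod_cast exploreLen_le hT3
  have first : N * Real.exp (-(exploreLen T / (4 * N))) ≤ 1 / (2 * T) := by
    have h1 : Real.exp (-(exploreLen T / (4 * N))) ≤ Real.exp (-(u ^ 2 / (4 * N))) := by
      gcongr
    have h2 : 2 * N * T ≤ Real.exp (u ^ 2 / (4 * N)) := by
      have h3 := Real.quadratic_le_exp_of_nonneg (x := u ^ 2 / (4 * N)) (by positivity)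
      have h4 : 0 ≤ u ^ 2 / (4 * N) := by positivity
      have h5 : 2 * N * T ≤ (u ^ 2 / (4 * N)) ^ 2 / 2 := by
        rw [← hu3, div_pow, div_div, le_div_iff₀ (by positivity)]
        calc 2 * N * u ^ 3 * ((4 * N) ^ 2 * 2) = (64 * N ^ 3) * u ^ 3 := by ring
          _ ≤ u * u ^ 3 := by gcongr
          _ = (u ^ 2) ^ 2 := by ring
      linarith
    calc N * Real.exp (-(exploreLen T / (4 * N)))
        ≤ N * Real.exp (-(u ^ 2 / (4 * N))) := by gcongr
      _ = N / Real.exp (u ^ 2 / (4 * N)) := by rw [Real.exp_neg]; rfl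
      _ ≤ N / (2 * N * T) := by gcongr
      _ = 1 / (2 * T) := by field_simp
  have hlogeq : 4 * (T : ℝ) * n * m = 4 * T * N := by rw [hN]; ring
  rw [hlogeq]
  set ℓ := Real.log (4 * T * N) with hℓ
  have hTN : (T : ℝ) ≤ 4 * T * N := by nlinarith
  have hexpℓ : Real.exp ℓ = 4 * T * N := Real.exp_log (by positivity)
  have hℓV : 12 * V ≤ ℓ := by
    rw [hℓ, Real.le_log_iff_exp_le (by positivity)]
    exact hTV.trans hTN
  have second : N * (2 * exploreLen T * Real.exp (-(ℓ ^ 2 / (4 * V)))) ≤ 1 / (2 * T) := by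
    have h1 : 3 * ℓ ≤ ℓ ^ 2 / (4 * V) := by
      rw [le_div_iff₀ (by positivity)]
      nlinarith
    have h2 : Real.exp (-(ℓ ^ 2 / (4 * V))) ≤ 1 / (4 * T * N) ^ 3 := by
      calc _ ≤ Real.exp (-(3 * ℓ)) := by gcongr
        _ = 1 / (4 * T * N) ^ 3 := by
          rw [Real.exp_neg, ← hexpℓ, ← Real.exp_nat_mul, one_div]
          norm_num
    calc N * (2 * exploreLen T * Real.exp (-(ℓ ^ 2 / (4 * V))))
        ≤ N * (2 * T * (1 / (4 * T * N) ^ 3)) := by gcongr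
      _ = 1 / (32 * (T * T) * (N * N)) := by field_simp; norm_num
      _ ≤ 1 / (2 * T) := by
        have h3 : (T : ℝ) ≤ T * T := by nlinarith
        have h4 : 1 ≤ N * N := by nlinarith
        have h5 : (T : ℝ) * T ≤ T * T * (N * N) := by nlinarith
        exact one_div_le_one_div_of_le (by positivity) (by linarith)
  calc _ = N * Real.exp (-(exploreLen T / (4 * N))) +
        N * (2 * exploreLen T * Real.exp (-(ℓ ^ 2 / (4 * V)))) := by ring
    _ ≤ 1 / (2 * T) + 1 / (2 * T) := add_le_add first second
    _ = 1 / T := by field_simp; norm_num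

/-- Deterministic guarantee of fair explore-then-commit on good data. -/
lemma GoodData.fair_and_regret_le {Ω : Type*} {T : ℕ} (hT : 3 ≤ T) (hn : 0 < n) (hm : 0 < m)
    {a b : ℝ} (ha : 0 < a) (hab : a ≤ b) {𝒞 : ConstraintFamily n m}
    (h𝒞 : 𝒞 = efConstraints n m ∨ 𝒞 = propConstraints n m) {K : ℝ} (hK0 : 0 ≤ K)
    (hK : ∀ r > 0, ∀ μ Y : Mat n m, (∀ i k, a ≤ μ i k ∧ μ i k ≤ b) →
      Y ∈ fairSet 𝒞 μ → ∃ X', IsAllocation X' ∧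
        (∀ μ' : Mat n m, (∀ i k, |μ' i k - μ i k| ≤ r) → 𝒞.Sat μ' X') ∧
        frob Y μ - frob X' μ ≤ K * r)
    {Xhat : History n m (exploreLen T) → Mat n m} (hXhat : IsRobustSolver 𝒞 T Xhat)
    {typ : ℕ → Ω → Fin m} {rec : ℕ → Ω → Fin n} {val : ℕ → Ω → Fin n → ℝ} {ω : Ω}
    {μ Y : Mat n m} (hμ : ∀ i k, a ≤ μ i k ∧ μ i k ≤ b) (hY : Y ∈ fairSet 𝒞 μ)
    (hgood : GoodData T μ (history typ rec val (exploreLen T) ω)) :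
    (∀ t < T, 𝒞.Sat μ (fairETC T Xhat t (history typ rec val t ω))) ∧
      regret (fairETC T Xhat) μ Y T typ rec val ω ≤
        (2 * (m * b) + (2 * K + 2 * m) * (2 * (n * m)) * (Real.log (4 * n * m) + 1)) *
          (T : ℝ) ^ (2 / 3 : ℝ) * Real.log T ^ 1 := by
  have hT1 : 1 ≤ T := by omega
  have hT' : (3 : ℝ) ≤ T := by exact_mod_cast hT
  have hn' : (1 : ℝ) ≤ n := by exact_mod_cast hn
  have hm' : (1 : ℝ) ≤ m := by exact_mod_cast hm
  have hnm : 1 ≤ (n : ℝ) * m := one_le_mul_of_one_le_of_one_le hn' hm'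
  have hb : 0 < b := ha.trans_le hab
  set u := (T : ℝ) ^ (1 / 3 : ℝ) with hu
  have hu0 : 0 < u := by positivity
  set ρ := Real.log (4 * T * n * m) * (2 * (n * m)) / u with hρ
  have hlogT : 1 ≤ Real.log T := by
    rw [Real.le_log_iff_exp_le (by positivity)]
    linarith [Real.exp_one_lt_d9]
  have hlogc : 0 ≤ Real.log (4 * n * m) := Real.log_nonneg (by linarith)
  have hlog : Real.log (4 * T * n * m) = Real.log (4 * n * m) + Real.log T := by
    rw [← Real.log_mul (by positivity) (by positivity)]
    congr 1
    ring
  have hρ0 : 0 < ρ := by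
    have : 0 < Real.log (4 * T * n * m) := by linarith
    positivity
  obtain ⟨X', hX', hrob, hloss⟩ := hK (2 * ρ) (by positivity) μ Y hμ hY
  obtain ⟨hsat, hfrob⟩ := hgood.sat_and_frob_sub_le
    (fun i k => hgood.radius_le hT1 hn hm i k) (hXhat _) hX' hrob hloss
  refine ⟨fun t _ => ?_, ?_⟩
  · by_cases ht : t < exploreLen T
    · rw [fairETC_of_lt _ ht]
      exact sat_uar hn h𝒞 μ
    · rw [fairETC_history_of_le _ (not_lt.1 ht)]
      exact hsat
  · refine (regret_fairETC_le hT1 hn Xhat (fun i k => ⟨ha.le.trans (hμ i k).1, (hμ i k).2⟩)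
      hY.1 hb.le (by positivity) hfrob).trans ?_
    have hTρ : T * ρ = Real.log (4 * T * n * m) * (2 * (n * m)) * (T : ℝ) ^ (2 / 3 : ℝ) := by
      have h3 : u ^ 3 = T := cube_rpow_one_third (by positivity)
      rw [rpow_two_thirds (by positivity), ← hu, hρ]
      nth_rewrite 1 [← h3]
      field_simp
    have hlog' : Real.log (4 * T * n * m) ≤ (Real.log (4 * n * m) + 1) * Real.log T := by
      rw [hlog]
      nlinarith
    set w := (T : ℝ) ^ (2 / 3 : ℝ) with hw
    have hw0 : 0 < w := by positivity
    calc 2 * (m * b) * w + T * (K * (2 * ρ) + 2 * m * ρ)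
        = 2 * (m * b) * w + (2 * K + 2 * m) * (T * ρ) := by ring
      _ = 2 * (m * b) * w * 1 +
          (2 * K + 2 * m) * (Real.log (4 * T * n * m) * (2 * (n * m)) * w) := by rw [hTρ]; ring
      _ ≤ 2 * (m * b) * w * Real.log T + (2 * K + 2 * m) *
          ((Real.log (4 * n * m) + 1) * Real.log T * (2 * (n * m)) * w) := by gcongr
      _ = _ := by ring

end Regret

end FairDivision

theorem theorem1 (n m : ℕ) (a b : ℝ) (ha : 0 < a) (σ : ℝ≥0)
    (𝒞 : FairDivision.ConstraintFamily n m)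
    (h𝒞 : 𝒞 = FairDivision.efConstraints n m ∨ 𝒞 = FairDivision.propConstraints n m) :
    ∃ (C : ℝ) (p T₀ : ℕ), ∀ T : ℕ, T₀ ≤ T →
      ∀ (ν : Fin n → Fin m → Measure ℝ) [∀ i k, IsProbabilityMeasure (ν i k)],
        FairDivision.IsSubGaussian ν σ →
        (∀ i k, a ≤ FairDivision.meanMatrix ν i k ∧ FairDivision.meanMatrix ν i k ≤ b) →
      ∀ Xhat : FairDivision.History n m (FairDivision.exploreLen T) → FairDivision.Mat n m,
        FairDivision.IsRobustSolver 𝒞 T Xhat →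
      ∀ (Ω : Type*) [MeasurableSpace Ω] (P : Measure Ω) [IsProbabilityMeasure P]
        (typ : ℕ → Ω → Fin m) (rec : ℕ → Ω → Fin n) (val : ℕ → Ω → Fin n → ℝ),
        FairDivision.IsOnlineProcess P ν (FairDivision.fairETC T Xhat) T typ rec val →
      ∀ Y : FairDivision.Mat n m,
        FairDivision.IsLPSolution (FairDivision.fairSet 𝒞 (FairDivision.meanMatrix ν))
          (FairDivision.meanMatrix ν) Y →
        1 - 1 / (T : ℝ) ≤ P.real {ω |
          (∀ t < T, 𝒞.Sat (FairDivision.meanMatrix ν)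
            (FairDivision.fairETC T Xhat t (FairDivision.history typ rec val t ω))) ∧
          FairDivision.regret (FairDivision.fairETC T Xhat) (FairDivision.meanMatrix ν) Y T
            typ rec val ω ≤ C * (T : ℝ) ^ (2 / 3 : ℝ) * Real.log T ^ p} := by
  -- Otherwise there is no instance: any outcome supplies a player and a type, whose mean lies
  -- between `a` and `b`.
  by_cases hpos : 0 < n ∧ 0 < m ∧ a ≤ b
  swap
  · refine ⟨0, 0, 0, fun T _ ν _ _ hmean _ _ Ω _ P _ typ rec _ _ _ _ => absurd ?_ hpos⟩
    obtain ⟨ω⟩ := nonempty_of_isProbabilityMeasure P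
    have h := hmean (rec 0 ω) (typ 0 ω)
    exact ⟨(rec 0 ω).pos, (typ 0 ω).pos, h.1.trans h.2⟩
  obtain ⟨hn, hm, hab⟩ := hpos
  obtain ⟨K, hK0, hK⟩ := FairDivision.exists_robust hn hm ha hab h𝒞
  -- The added `1` keeps the variance bound positive when `σ = 0`, since the tilts divide by it.
  have hV : 0 < (σ : ℝ) ^ 2 + 1 := by positivity
  obtain ⟨T₀, hT₀, hfail⟩ := FairDivision.exists_failure_prob_le hn hm hV
  refine ⟨2 * (m * b) + (2 * K + 2 * m) * (2 * (n * m)) * (Real.log (4 * n * m) + 1), 1, T₀, ?_⟩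
  intro T hT ν _ hν hmean Xhat hXhat Ω _ P _ typ rec val hproc Y hY
  set S : Set Ω := {ω | (∀ t < T, 𝒞.Sat (FairDivision.meanMatrix ν)
    (FairDivision.fairETC T Xhat t (FairDivision.history typ rec val t ω))) ∧
    FairDivision.regret (FairDivision.fairETC T Xhat) (FairDivision.meanMatrix ν) Y T
      typ rec val ω ≤
        (2 * (m * b) + (2 * K + 2 * m) * (2 * (n * m)) * (Real.log (4 * n * m) + 1)) *
          (T : ℝ) ^ (2 / 3 : ℝ) * Real.log T ^ 1} with hS
  have hbad := hproc.measure_not_goodData_le (FairDivision.exploreLen_le (by omega))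
    (fun t ht H => FairDivision.fairETC_of_lt Xhat ht H) hn hm hν hV (by linarith)
  have hcompl : Sᶜ ⊆ {ω | ¬ FairDivision.GoodData T (FairDivision.meanMatrix ν)
      (FairDivision.history typ rec val (FairDivision.exploreLen T) ω)} := fun ω hω hgood =>
    hω (hgood.fair_and_regret_le (hT₀.trans hT) hn hm ha hab h𝒞 hK0 hK hXhat hmean hY.1)
  have h1 : P.real Sᶜ ≤ 1 / (T : ℝ) :=
    ENNReal.toReal_le_of_le_ofReal (by positivity)
      ((measure_mono hcompl).trans (hbad.trans (ENNReal.ofReal_le_ofReal (hfail T hT))))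
  -- Subadditivity is enough here: `S` need not be measurable, because `Xhat` is an arbitrary
  -- solver.
  have h2 : P.real (Set.univ : Set Ω) ≤ P.real S + P.real Sᶜ := by
    rw [← Set.union_compl_self S]
    exact measureReal_union_le S Sᶜ
  rw [probReal_univ] at h2
  linarith
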